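/- **Setting.** A set species $H$ is a functor from finite sets and bijections to sets, and $\mathbb K H$ denotes its linearization over a field $\mathbb K$, the functor $N\mapsto \mathbb K H[N]$, the vector space with basis $H[N]$. A *linearized Hopf monoid* is a set species $H$ together with a connected Hopf monoid structure $(\mu,\Delta)$ on $\mathbb K H$ (so $\dim \mathbb K H[\emptyset]=1$) such that for disjoint finite sets $M,N$ the product of $x\in H[M]$, $y\in H[N]$ is an element $x\cdot y\in H[M\sqcup N]$, and for $h\in H[M\sqcup N]$ either $\Delta_{M,N}(h)=0$ or $\Delta_{M,N}(h)=h|_M\otimes h/M$ with $h|_M\in H[M]$, $h/M\in H[N]$. A *linearized character* $\varphi$ is a family of linear maps $\varphi_N:\mathbb K H[N]\to\mathbb K$, natural in bijections, with $\varphi(x\cdot y)=\varphi(x)\varphi(y)$ and $\varphi(h)\in\{0,1\}$ for all structures $h$. It is *balanced convex* if for every finite set $N$ and $h\in H[N]$: (1) if $|N|=1$ then $\varphi(h)=1$; (2) if $|N|>1$ there is $\emptyset\ne S\subsetneq N$ with $\Delta_{S,N\setminus S}(h)\neq 0$; (3) if $\varphi(h)=1$, $S\subseteq N$ and $\Delta_{S,N\setminus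 S}(h)\ne0$, then $\varphi(h|_S)=\varphi(h/S)=1$. Fix a finite set $N$, $h\in H[N]$, and a subgroup $\mathfrak G$ of $\operatorname{Aut}(h)=\{\mathfrak g\in\mathfrak S_N: H[\mathfrak g](h)=h\}$. A coloring $f:N\to\{1,2,\dots\}$ is *$\varphi$-proper* if for every color $i$ that is used, with $N_{<i}=f^{-1}(\{1,\dots,i-1\})$ and $N_{\le i}=f^{-1}(\{1,\dots,i\})$, the structure $(h|_{N_{\le i}})/N_{<i}$ is defined (the coproducts involved are nonzero) and $\varphi\big((h|_{N_{\le i}})/N_{<i}\big)=1$. The group $\mathfrak G$ acts on the set $F_\varphi(h)$ of $\varphi$-proper colorings by $\mathfrak g f=f\circ\mathfrak g^{-1}$. Write $\mathbf x^f=\prod_{v\in N}x_{f(v)}$, and for $\mathfrak g\in\mathfrak G$ and $k\in\mathbb N$ set $$\Psi(h,\mathfrak G,\mathbf x;\mathfrak g)=\sum_{f\in F_\varphi(h),\ \mathfrak gf=f}\mathbf x^f,\qquad \Psi^O(h,\mathfrak G,\mathbf x)=\sum_{C\in F_\varphi(h)/\mathfrak G}\mathbf x^{C},$$ where $\mathbf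 x^C=\mathbf x^f$ for any $f\in C$; $$\Psi(h,\mathfrak G,k;\mathfrak g)=\#\{f\in F_\varphi(h): \mathfrak gf=f,\ f(N)\subseteq[k]\},\qquad \Psi^O(h,\mathfrak G,k)=\#\big(\{f\in F_\varphi(h): f(N)\subseteq[k]\}/\mathfrak G\big).$$ For characters of finite-dimensional complex representations of $\mathfrak G$ (effective characters, including $0$) write $\chi\le_{\mathfrak G}\psi$ if $\psi-\chi$ is again such a character. For a composition $\alpha=(\alpha_1,\dots,\alpha_k)$ of $n$ let $M_\alpha=\sum_{i_1<\dots<i_k}x_{i_1}^{\alpha_1}\cdots x_{i_k}^{\alpha_k}$, and write $\alpha\le\beta$ if $\beta$ refines $\alpha$. A quasisymmetric class function $\sum_{\alpha\models n}c_\alpha M_\alpha$ is *$M$-increasing* if the $c_\alpha$ are effective characters with $c_\alpha\le_{\mathfrak G}c_\beta$ whenever $\alpha\le\beta$; a quasisymmetric function $\sum_{\alpha\models n}c_\alpha M_\alpha$ is *$M$-increasing* if its coefficients are real with $c_\alpha\le c_\beta$ whenever $\alpha\le\beta$. The $f$-vector $(f_0,\dots,f_d)$ of a polynomial (class function) $p$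 of degree $d$ is given by $p(x)=\sum_{i=0}^d f_i\binom xi$, with $f_i=0$ for $i>d$. A polynomial is *strongly flawless* if $f_i\le f_{i+1}$ for $0\le i\le\frac{d-1}2$ and $f_i\le f_{d-i}$ for $0\le i\le \frac d2$. A polynomial class function is *effectively flawless* if its $f_i$ are effective characters and the same inequalities hold with $\le_{\mathfrak G}$. **Theorem.** Let $H$ be a linearized Hopf monoid with a linearized balanced convex character $\varphi$, let $h\in H[N]$ for a finite set $N$, and let $\mathfrak G\subseteq\operatorname{Aut}(h)$ be a subgroup. 1. $\Psi(h,\mathfrak G,\mathbf x)$ is a quasisymmetric class function and $\Psi^O(h,\mathfrak G,\mathbf x)$ is a quasisymmetric function, both homogeneous of degree $|N|$, and both are $M$-increasing. 2. $\Psi(h,\mathfrak G,x)$ is a polynomial class function of degree $|N|$ (its value at the identity has degree $|N|$), it is effectively flawless, and its $f$-vector satisfies $(|N|-i)f_i\le_{\mathfrak G} i f_{i+1}$ for all $i\ge 0$. 3. $\Psi^O(h,\mathfrak G,x)$ is a polynomial of degree $|N|$, it is strongly flawless, and its $f$-vector satisfies $(|N|-i)f_i\le i f_{i+1}$ for all $i\ge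 0$. -/

import Mathlib

open scoped TensorProduct

universe u v

noncomputable section

/-! ### Species and Hopf monoids in species -/

/-- A linear species over `K`: a functor from finite sets and bijections to `K`-vector spaces
(additive inverses come from the scalar `-1`). -/
structure LinSpecies (K : Type*) [Field K] where
  obj : (N : Type u) → [Finite N] → Type v
  [addCommMonoid : ∀ (N : Type u) [Finite N], AddCommMonoid (obj N)]
  [module : ∀ (N : Type u) [Finite N], Module K (obj N)]
  map : ∀ {M N : Type u} [Finite M] [Finite N], (M ≃ N) → (obj M →ₗ[K] obj N)
  map_refl : ∀ (N : Type u) [Finite N], map (Equiv.refl N) = LinearMap.id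
  map_trans : ∀ {L M N : Type u} [Finite L] [Finite M] [Finite N] (e : L ≃ M) (e' : M ≃ N),
    map (e.trans e') = map e' ∘ₗ map e

attribute [instance] LinSpecies.addCommMonoid LinSpecies.module

/-- A set species: a functor from finite sets and bijections to sets. -/
structure SetSpecies where
  obj : (N : Type u) → [Finite N] → Type v
  map : ∀ {M N : Type u} [Finite M] [Finite N], (M ≃ N) → obj M → obj N
  map_refl : ∀ (N : Type u) [Finite N] (h : obj N), map (Equiv.refl N) h = h
  map_trans : ∀ {L M N : Type u} [Finite L] [Finite M] [Finite N] (e : L ≃ M) (e' : M ≃ N)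
    (h : obj L), map (e.trans e') h = map e' (map e h)

/-- A connected Hopf monoid in linear species. The disjoint union of two finite sets is `M ⊕ N`.
The axioms are those of a connected bimonoid; since the species is connected, the antipode exists
automatically (and is unique), and the counit is the functional on `V[∅]` taking `one` to `1`. -/
structure HopfMonoid {K : Type*} [Field K] (V : LinSpecies.{u, v} K) where
  mul : ∀ (M N : Type u) [Finite M] [Finite N],
    V.obj M ⊗[K] V.obj N →ₗ[K] V.obj (M ⊕ N)
  comul : ∀ (M N : Type u) [Finite M] [Finite N],
    V.obj (M ⊕ N) →ₗ[K] V.obj M ⊗[K] V.obj N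
  one : V.obj PEmpty.{u + 1}
  connected : Module.finrank K (V.obj PEmpty.{u + 1}) = 1
  mul_natural : ∀ {M M' N N' : Type u} [Finite M] [Finite M'] [Finite N] [Finite N']
    (e : M ≃ M') (e' : N ≃ N'),
    V.map (Equiv.sumCongr e e') ∘ₗ mul M N = mul M' N' ∘ₗ TensorProduct.map (V.map e) (V.map e')
  comul_natural : ∀ {M M' N N' : Type u} [Finite M] [Finite M'] [Finite N] [Finite N']
    (e : M ≃ M') (e' : N ≃ N'),
    comul M' N' ∘ₗ V.map (Equiv.sumCongr e e') =
      TensorProduct.map (V.map e) (V.map e') ∘ₗ comul M N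
  mul_assoc : ∀ (L M N : Type u) [Finite L] [Finite M] [Finite N],
    V.map (Equiv.sumAssoc L M N) ∘ₗ mul (L ⊕ M) N ∘ₗ
        TensorProduct.map (mul L M) LinearMap.id =
      mul L (M ⊕ N) ∘ₗ TensorProduct.map LinearMap.id (mul M N) ∘ₗ
        (TensorProduct.assoc K (V.obj L) (V.obj M) (V.obj N)).toLinearMap
  one_mul : ∀ (N : Type u) [Finite N] (x : V.obj N),
    V.map (Equiv.emptySum PEmpty.{u + 1} N) (mul PEmpty.{u + 1} N (one ⊗ₜ[K] x)) = x
  mul_one : ∀ (N : Type u) [Finite N] (x : V.obj N),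
    V.map (Equiv.sumEmpty N PEmpty.{u + 1}) (mul N PEmpty.{u + 1} (x ⊗ₜ[K] one)) = x
  coassoc : ∀ (L M N : Type u) [Finite L] [Finite M] [Finite N],
    (TensorProduct.assoc K (V.obj L) (V.obj M) (V.obj N)).toLinearMap ∘ₗ
        TensorProduct.map (comul L M) LinearMap.id ∘ₗ comul (L ⊕ M) N =
      TensorProduct.map LinearMap.id (comul M N) ∘ₗ comul L (M ⊕ N) ∘ₗ
        V.map (Equiv.sumAssoc L M N)
  counit_left : ∀ (N : Type u) [Finite N] (x : V.obj N),
    comul PEmpty.{u + 1} N (V.map (Equiv.emptySum PEmpty.{u + 1} N).symm x) = one ⊗ₜ[K] x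
  counit_right : ∀ (N : Type u) [Finite N] (x : V.obj N),
    comul N PEmpty.{u + 1} (V.map (Equiv.sumEmpty N PEmpty.{u + 1}).symm x) = x ⊗ₜ[K] one
  compat : ∀ (A B C D : Type u) [Finite A] [Finite B] [Finite C] [Finite D],
    comul (A ⊕ C) (B ⊕ D) ∘ₗ V.map (Equiv.sumSumSumComm A B C D) ∘ₗ mul (A ⊕ B) (C ⊕ D) =
      TensorProduct.map (mul A C) (mul B D) ∘ₗ
        (TensorProduct.tensorTensorTensorComm K
          (V.obj A) (V.obj B) (V.obj C) (V.obj D)).toLinearMap ∘ₗ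
        TensorProduct.map (comul A B) (comul C D)

/-- The component `V[N] → V[S] ⊗ V[N ∖ S]` of the comultiplication, for a subset `S` of `N`. -/
def HopfMonoid.comulAt {K : Type*} [Field K] {V : LinSpecies.{u, v} K} (X : HopfMonoid V)
    {N : Type u} [Finite N] (S : Set N) :
    V.obj N →ₗ[K] V.obj ↥S ⊗[K] V.obj ↥Sᶜ :=
  letI : DecidablePred (· ∈ S) := Classical.decPred _
  X.comul ↥S ↥Sᶜ ∘ₗ V.map (Equiv.Set.sumCompl S).symm

/-- A character of a Hopf monoid: a multiplicative natural transformation to the linearized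
exponential species, whose value on each finite set is identified with the field. -/
structure HopfMonoid.Character {K : Type*} [Field K] {V : LinSpecies.{u, v} K}
    (X : HopfMonoid V) where
  toFun : ∀ (N : Type u) [Finite N], V.obj N →ₗ[K] K
  natural : ∀ {M N : Type u} [Finite M] [Finite N] (e : M ≃ N) (x : V.obj M),
    toFun N (V.map e x) = toFun M x
  mul : ∀ (M N : Type u) [Finite M] [Finite N] (x : V.obj M) (y : V.obj N),
    toFun (M ⊕ N) (X.mul M N (x ⊗ₜ[K] y)) = toFun M x * toFun N y

/-! ### Linearized combinatorial Hopf monoids -/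

namespace SetSpecies

/-- The linearization of a set species. -/
@[reducible] def linearization (K : Type*) [Field K] (H : SetSpecies.{u, v}) : LinSpecies K where
  obj N _ := H.obj N →₀ K
  map e := Finsupp.lmapDomain K K (H.map e)
  map_refl N _ := by
    have : H.map (Equiv.refl N) = id := funext (H.map_refl N)
    rw [this, Finsupp.lmapDomain_id]
  map_trans e e' := by
    have : H.map (e.trans e') = H.map e' ∘ H.map e := funext (H.map_trans e e')
    rw [this, Finsupp.lmapDomain_comp]

/-- The basis vector of the linearization given by a structure. -/
def vec (K : Type*) [Field K] (H : SetSpecies.{u, v}) {N : Type u} [Finite N] (h : H.obj N) :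
    (H.linearization K).obj N :=
  Finsupp.single h 1

/-- The automorphism group of a structure. -/
def aut (H : SetSpecies.{u, v}) {N : Type u} [Finite N] (h : H.obj N) :
    Subgroup (Equiv.Perm N) where
  carrier := {g | H.map g h = h}
  one_mem' := H.map_refl N h
  mul_mem' {a b} ha hb := by
    have := H.map_trans b a h
    simp only [Set.mem_ofPred_eq] at ha hb ⊢
    rw [hb, ha] at this
    exact this
  inv_mem' {a} ha := by
    have h1 := H.map_trans a a.symm h
    simp only [Set.mem_ofPred_eq] at ha ⊢
    rw [ha, Equiv.self_trans_symm, H.map_refl] at h1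
    exact h1.symm

end SetSpecies

namespace HopfMonoid

variable {K : Type*} [Field K] {H : SetSpecies.{u, v}}

/-- A Hopf monoid structure on `K H` is linearized if products of structures are structures, and
coproducts of structures are either zero or a tensor product of two structures. -/
structure IsLinearized (X : HopfMonoid (H.linearization K)) : Prop where
  mul : ∀ (M N : Type u) [Finite M] [Finite N] (x : H.obj M) (y : H.obj N),
    ∃ z : H.obj (M ⊕ N), X.mul M N (H.vec K x ⊗ₜ[K] H.vec K y) = H.vec K z
  comul : ∀ (M N : Type u) [Finite M] [Finite N] (z : H.obj (M ⊕ N)),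
    X.comul M N (H.vec K z) = 0 ∨
      ∃ (x : H.obj M) (y : H.obj N), X.comul M N (H.vec K z) = H.vec K x ⊗ₜ[K] H.vec K y

/-- `X.Splits h S x y` says that `Δ_{S, N ∖ S}(h) = x ⊗ y`, that is, the coproduct is nonzero,
`h|_S = x` and `h/S = y`. -/
def Splits (X : HopfMonoid (H.linearization K)) {N : Type u} [Finite N] (h : H.obj N)
    (S : Set N) (x : H.obj ↥S) (y : H.obj ↥Sᶜ) : Prop :=
  X.comulAt S (H.vec K h) = H.vec K x ⊗ₜ[K] H.vec K y

/-- `X.IsMinor h A B z` says, for subsets `A ⊆ B` of `N`, that the structure `(h|_B)/A` is defined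
and equal to `z`. -/
def IsMinor (X : HopfMonoid (H.linearization K)) {N : Type u} [Finite N] (h : H.obj N)
    (A B : Set N) (z : H.obj ↥({v : ↥B | (v : N) ∈ A}ᶜ)) : Prop :=
  ∃ (x : H.obj ↥B) (y : H.obj ↥Bᶜ) (w : H.obj ↥{v : ↥B | (v : N) ∈ A}),
    X.Splits h B x y ∧ X.Splits x {v : ↥B | (v : N) ∈ A} w z

namespace Character

variable {X : HopfMonoid (H.linearization K)}

/-- The value of a character at a structure. -/
def val (φ : X.Character) {N : Type u} [Finite N] (h : H.obj N) : K :=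
  φ.toFun N (H.vec K h)

/-- A linearized character takes only the values `0` and `1` on structures. -/
def IsLinearized (φ : X.Character) : Prop :=
  ∀ (N : Type u) [Finite N] (h : H.obj N), φ.val h = 0 ∨ φ.val h = 1

/-- Balanced convex characters. -/
structure IsBalancedConvex (φ : X.Character) : Prop where
  singleton : ∀ (N : Type u) [Finite N] (h : H.obj N), Nat.card N = 1 → φ.val h = 1
  decomposable : ∀ (N : Type u) [Finite N] (h : H.obj N), 1 < Nat.card N →
    ∃ S : Set N, S.Nonempty ∧ S ≠ Set.univ ∧ X.comulAt S (H.vec K h) ≠ 0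
  convex : ∀ (N : Type u) [Finite N] (h : H.obj N), φ.val h = 1 →
    ∀ (S : Set N) (x : H.obj ↥S) (y : H.obj ↥Sᶜ), X.Splits h S x y → φ.val x = 1 ∧ φ.val y = 1

/-- `f` is a `φ`-proper coloring of `h`: for every color `i` that is used,
`φ((h|_{f ≤ i}) / {f < i}) = 1`. Colors are positive integers. -/
def IsProper (φ : X.Character) {N : Type u} [Finite N] (h : H.obj N) (f : N → ℕ+) : Prop :=
  ∀ i ∈ Set.range f, ∃ z, X.IsMinor h {v | f v < i} {v | f v ≤ i} z ∧ φ.val z = 1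

/-- The set of `φ`-proper colorings. -/
def Colorings (φ : X.Character) {N : Type u} [Finite N] (h : H.obj N) : Set (N → ℕ+) :=
  {f | φ.IsProper h f}

end Character

end HopfMonoid

/-! ### Quasisymmetric functions and class functions -/

/-- The generating function `∑_{s} x^{w s}` over a set of objects with weights having finite fibers:
its coefficient at a monomial is the number of objects with that weight. -/
def genFun {S : Type*} (w : S → (ℕ+ →₀ ℕ)) : MvPowerSeries ℕ+ ℂ :=
  fun m => (Nat.card {s : S // w s = m} : ℂ)

/-- The exponent of the monomial `x^f = ∏_{v} x_{f v}`. -/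
def colorWeight {N : Type u} [Fintype N] (f : N → ℕ+) : ℕ+ →₀ ℕ :=
  ∑ v, Finsupp.single (f v) 1

/-- The monomial quasisymmetric function
`M_α = ∑_{i_1 < ⋯ < i_k} x_{i_1}^{α_1} ⋯ x_{i_k}^{α_k}`. -/
def monomialQSym {n : ℕ} (α : Composition n) : MvPowerSeries ℕ+ ℂ :=
  genFun (S := {i : Fin α.length → ℕ+ // StrictMono i})
    fun i => ∑ j, Finsupp.single (i.1 j) (α.blocksFun j)

/-- `Refines α β`: the composition `β` is a refinement of `α` (written `α ≤ β`), that is, every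
partial sum of `α` is a partial sum of `β`. -/
def Refines {n : ℕ} (α β : Composition n) : Prop :=
  α.boundaries ⊆ β.boundaries

/-- Effective characters: the characters of finite-dimensional complex representations. -/
def IsEffective {G : Type*} [Group G] (χ : G → ℂ) : Prop :=
  ∃ (V : Type) (_ : AddCommGroup V) (_ : Module ℂ V) (_ : FiniteDimensional ℂ V)
    (ρ : Representation ℂ G V), χ = ρ.character

/-- The order `χ ≤_G ψ` on effective characters: `ψ - χ` is an effective character. -/
structure EffLE {G : Type*} [Group G] (χ ψ : G → ℂ) : Prop where
  left : IsEffective χ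
  right : IsEffective ψ
  sub : IsEffective (ψ - χ)

/-- A function `F` from `G` to power series is an `M`-increasing quasisymmetric class function,
homogeneous of degree `n`: its coefficients in the basis of monomial quasisymmetric functions are
effective characters of `G`, increasing with respect to refinement. -/
def IsMIncreasingClass {G : Type*} [Group G] (n : ℕ) (F : G → MvPowerSeries ℕ+ ℂ) : Prop :=
  ∃ c : Composition n → G → ℂ,
    (∀ g, F g = ∑ α, c α g • monomialQSym α) ∧ ∀ α β, Refines α β → EffLE (c α) (c β)

/-- A power series is an `M`-increasing quasisymmetric function, homogeneous of degree `n`. -/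
def IsMIncreasing (n : ℕ) (F : MvPowerSeries ℕ+ ℂ) : Prop :=
  ∃ c : Composition n → ℝ,
    F = ∑ α, (c α : ℂ) • monomialQSym α ∧ ∀ α β, Refines α β → c α ≤ c β

/-! ### Polynomials and their `f`-vectors -/

/-- The polynomial `binom(x, i) = x (x - 1) ⋯ (x - i + 1) / i!`. -/
def binomPoly (R : Type*) [Field R] (i : ℕ) : Polynomial R :=
  Polynomial.C ((i.factorial : R)⁻¹) * descPochhammer R i

/-- `f` is the `f`-vector of the polynomial `p`, of degree `d`: `p = ∑_{i ≤ d} f_i binom(x, i)`.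
Entries beyond the degree are zero. -/
structure IsFVector {R : Type*} [Field R] (d : ℕ) (p : Polynomial R) (f : ℕ → R) : Prop where
  natDegree_eq : p.natDegree = d
  eq_sum : p = ∑ i ∈ Finset.range (d + 1), Polynomial.C (f i) * binomPoly R i
  eq_zero : ∀ i, d < i → f i = 0

/-- `f` is the equivariant `f`-vector of the polynomial class function `p`, of degree `d` (the
degree being attained at the identity): `p = ∑_{i ≤ d} f_i binom(x, i)` where the `f_i` are
characters. Entries beyond the degree are zero. -/
structure IsEquivariantFVector {G : Type*} [Group G] (d : ℕ) (p : G → Polynomial ℂ)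
    (f : ℕ → G → ℂ) : Prop where
  natDegree_eq : (p 1).natDegree = d
  effective : ∀ i, IsEffective (f i)
  eq_sum : ∀ g, p g = ∑ i ∈ Finset.range (d + 1), Polynomial.C (f i g) * binomPoly ℂ i
  eq_zero : ∀ i, d < i → f i = 0

/-- The inequalities of a strongly flawless `f`-vector `(f_0, …, f_d)`. -/
structure IsStronglyFlawless (d : ℕ) (f : ℕ → ℝ) : Prop where
  le_succ : ∀ i, 2 * i + 1 ≤ d → f i ≤ f (i + 1)
  le_reflect : ∀ i, 2 * i ≤ d → f i ≤ f (d - i)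

/-- The inequalities of an effectively flawless equivariant `f`-vector `(f_0, …, f_d)`. -/
structure IsEffectivelyFlawless {G : Type*} [Group G] (d : ℕ) (f : ℕ → G → ℂ) : Prop where
  le_succ : ∀ i, 2 * i + 1 ≤ d → EffLE (f i) (f (i + 1))
  le_reflect : ∀ i, 2 * i ≤ d → EffLE (f i) (f (d - i))

/-! ### Chromatic invariants -/

/-- The equivalence `f ∼ f'` if `f = f' ∘ g⁻¹` for some `g` in `G`, on a set of colorings. -/
def orbitSetoid {N : Type u} (G : Subgroup (Equiv.Perm N)) (F : Set (N → ℕ+)) : Setoid ↥F where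
  r f f' := ∃ g ∈ G, f.1 = f'.1 ∘ ⇑g⁻¹
  iseqv :=
    { refl := fun _ => ⟨1, G.one_mem, by simp⟩
      symm := fun {f f'} ⟨g, hg, h⟩ => ⟨g⁻¹, G.inv_mem hg, by
        funext v
        simp [h]⟩
      trans := fun {f f' f''} ⟨g, hg, h⟩ ⟨g', hg', h'⟩ => ⟨g * g', G.mul_mem hg hg', by
        funext v
        simp [h, h', mul_inv_rev]⟩ }

namespace HopfMonoid.Character

variable {K : Type*} [Field K] {H : SetSpecies.{u, v}} {X : HopfMonoid (H.linearization K)}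

/-- The `φ`-chromatic quasisymmetric class function at `g`: the generating function of the
`φ`-proper colorings `f` with `f ∘ g⁻¹ = f`. -/
def chromaticQSym (φ : X.Character) {N : Type u} [Fintype N] (h : H.obj N)
    (g : Equiv.Perm N) : MvPowerSeries ℕ+ ℂ :=
  genFun (S := {f : N → ℕ+ // f ∈ φ.Colorings h ∧ f ∘ ⇑g⁻¹ = f}) fun f => colorWeight f.1

/-- The number of `φ`-proper colorings `f` with `f ∘ g⁻¹ = f` and colors in `{1, …, k}`: the value
at `k` and `g` of the `φ`-chromatic polynomial class function. -/
def chromaticCount (φ : X.Character) {N : Type u} [Finite N] (h : H.obj N)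
    (g : Equiv.Perm N) (k : ℕ) : ℕ :=
  Nat.card {f : N → ℕ+ // f ∈ φ.Colorings h ∧ f ∘ ⇑g⁻¹ = f ∧ ∀ v, (f v : ℕ) ≤ k}

/-- The orbital `φ`-chromatic quasisymmetric function: the generating function of the orbits of
`G` on the `φ`-proper colorings. -/
def orbitalQSym (φ : X.Character) {N : Type u} [Fintype N] (h : H.obj N)
    (G : Subgroup (Equiv.Perm N)) : MvPowerSeries ℕ+ ℂ :=
  genFun (S := Quotient (orbitSetoid G (φ.Colorings h)))
    (Quotient.lift (fun f => colorWeight f.1) (by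
      rintro f f' ⟨g, -, h⟩
      simp only [colorWeight, h, Function.comp_apply]
      exact Equiv.sum_comp g⁻¹ fun v => Finsupp.single (f'.1 v) 1))

/-- The number of orbits of `G` on the `φ`-proper colorings with colors in `{1, …, k}`: the value
at `k` of the orbital `φ`-chromatic polynomial. -/
def orbitalCount (φ : X.Character) {N : Type u} [Finite N] (h : H.obj N)
    (G : Subgroup (Equiv.Perm N)) (k : ℕ) : ℕ :=
  Nat.card (Quotient (orbitSetoid G {f | f ∈ φ.Colorings h ∧ ∀ v, (f v : ℕ) ≤ k}))

end HopfMonoid.Character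

end

/-! Properness depends only on the ordered set partition underlying a coloring. So a proper coloring
is, in a unique way, a strictly increasing choice of colors applied to a proper coloring with colors
`0, …, k - 1` whose class sizes form a composition α (`exists_typeColorings`,
`typeColorings_unique`). Hence Ψ = ∑ c_α M_α, where c_α(g) is the number of elements of
`TypeColorings` of type α fixed by g. This is a permutation character, so it is effective.

The heart is c_α ≤ c_β when β refines α (`effLE_typeCharacter`). Merging colors sends colorings of
type β to colorings with class sizes α and commutes with the group. The result may be improper, so
the map is only partial; its linearization sends the improper cases to 0. It is onto: each interval
between consecutive sublevel sets of a proper coloring is a minor on which φ is 1. By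
decomposability and coassociativity the minor has a complete flag all of whose intervals are minors
(`exists_flag`), and convexity keeps φ equal to 1 on them. Concatenating these flags gives a linear
order on N that cuts into a proper coloring along every β refining α
(`exists_order_of_mem_typeColorings`). A surjective intertwining map then yields the inequality, the
difference being the character of its kernel (`effLE_of_surjective`).

Restricting to k colors replaces M_α by binom(k, length α), so f_i is the sum of the c_α with α of
length i. Compositions of m + 1 under refinement form the Boolean lattice of rank m. The
inequalities for f therefore compare level sums of an increasing family: matchings between levels
give flawlessness, and counting covering pairs gives (n - i) f_i ≤ i f_{i+1}. The degree is n
because a complete flag of h is a proper coloring with one-point classes, φ being 1 on singletons.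

The orbital statements follow by averaging over the group: Burnside's lemma turns fixed-point counts
into orbit counts, and the average is linear and nonnegative on effective characters. -/

noncomputable section

/-! ### Effective characters -/

section Effective

variable {G : Type*} [Group G]

/-- The character of a finite-dimensional representation in any universe is effective. -/
theorem isEffective_character {V : Type*} [AddCommGroup V] [Module ℂ V] [FiniteDimensional ℂ V]
    (ρ : Representation ℂ G V) : IsEffective ρ.character := by
  -- `IsEffective` asks for a space in `Type`, so the representation is transported to coordinates.
  let e := (Module.finBasis ℂ V).equivFun
  refine ⟨Fin (Module.finrank ℂ V) → ℂ, inferInstance, inferInstance, inferInstance,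
    (e.conjRingEquiv : Module.End ℂ V →* _).comp ρ, ?_⟩
  funext g
  exact (LinearMap.trace_conj' (ρ g) e).symm

theorem IsEffective.zero : IsEffective (0 : G → ℂ) := by
  convert isEffective_character (G := G) (1 : Representation ℂ G PUnit.{1}) using 1
  funext g
  simp [Representation.character, Module.finrank_zero_of_subsingleton]

theorem IsEffective.add {χ ψ : G → ℂ} (hχ : IsEffective χ) (hψ : IsEffective ψ) :
    IsEffective (χ + ψ) := by
  obtain ⟨V, _, _, _, ρ, rfl⟩ := hχ
  obtain ⟨W, _, _, _, σ, rfl⟩ := hψ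
  convert isEffective_character (ρ.prod σ) using 1
  funext g
  exact (LinearMap.trace_prodMap' (ρ g) (σ g)).symm

theorem EffLE.refl {χ : G → ℂ} (h : IsEffective χ) : EffLE χ χ :=
  ⟨h, h, by rw [sub_self]; exact .zero⟩

theorem IsEffective.effLE_zero {χ : G → ℂ} (h : IsEffective χ) : EffLE 0 χ :=
  ⟨.zero, h, by rwa [sub_zero]⟩

theorem EffLE.add {χ ψ χ' ψ' : G → ℂ} (h : EffLE χ ψ) (h' : EffLE χ' ψ') :
    EffLE (χ + χ') (ψ + ψ') :=
  ⟨h.left.add h'.left, h.right.add h'.right, by rw [add_sub_add_comm]; exact h.sub.add h'.sub⟩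

theorem IsEffective.sum {ι : Type*} (s : Finset ι) {χ : ι → G → ℂ}
    (h : ∀ i ∈ s, IsEffective (χ i)) : IsEffective (∑ i ∈ s, χ i) :=
  Finset.sum_induction _ _ (fun _ _ => IsEffective.add) .zero h

theorem EffLE.sum {ι : Type*} (s : Finset ι) {χ ψ : ι → G → ℂ}
    (h : ∀ i ∈ s, EffLE (χ i) (ψ i)) : EffLE (∑ i ∈ s, χ i) (∑ i ∈ s, ψ i) := by
  refine ⟨.sum s fun i hi => (h i hi).left, .sum s fun i hi => (h i hi).right, ?_⟩
  rw [← Finset.sum_sub_distrib]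
  exact .sum s fun i hi => (h i hi).sub

/-- A surjective intertwining map shows that the character of its target is at most that of its
source: the difference is the character of the kernel. -/
theorem effLE_of_surjective {V W : Type*} [AddCommGroup V] [Module ℂ V] [FiniteDimensional ℂ V]
    [AddCommGroup W] [Module ℂ W] [FiniteDimensional ℂ W] (ρ : Representation ℂ G V)
    (σ : Representation ℂ G W) (T : V →ₗ[ℂ] W) (hT : ∀ g, T ∘ₗ ρ g = σ g ∘ₗ T)
    (hs : Function.Surjective T) : EffLE σ.character ρ.character := by
  refine ⟨isEffective_character σ, isEffective_character ρ, ?_⟩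
  have hT' : ∀ g x, T (ρ g x) = σ g (T x) := fun g x => LinearMap.congr_fun (hT g) x
  have hker : ∀ g, ∀ x ∈ LinearMap.ker T, ρ g x ∈ LinearMap.ker T := by
    intro g x hx
    rw [LinearMap.mem_ker] at hx ⊢
    rw [hT', hx, map_zero]
  let κ : Representation ℂ G (LinearMap.ker T) :=
    { toFun := fun g => (ρ g).restrict (hker g)
      map_one' := by ext; simp
      map_mul' := fun a b => by ext; simp }
  convert isEffective_character κ using 1
  funext g
  -- The section `s` is merely linear. Writing the identity as the projection `P` onto the kernel
  -- plus `s ∘ T` and using the cyclicity of the trace splits the trace of `ρ g`, so no invariant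
  -- complement is needed and `G` may be infinite.
  obtain ⟨s, hs⟩ := T.exists_rightInverse_of_surjective (LinearMap.range_eq_top.2 hs)
  have hs' : ∀ x, T (s x) = x := fun x => LinearMap.congr_fun hs x
  let P : V →ₗ[ℂ] LinearMap.ker T :=
    (LinearMap.id - s ∘ₗ T).codRestrict (LinearMap.ker T) fun x => by simp [hs']
  have h1 : ρ g = ρ g ∘ₗ (LinearMap.ker T).subtype ∘ₗ P + (ρ g ∘ₗ s) ∘ₗ T := by
    ext x
    simp [P]
  have h2 : P ∘ₗ ρ g ∘ₗ (LinearMap.ker T).subtype = κ g := by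
    ext x
    have : T x = 0 := x.2
    simp [P, κ, hT', this]
  have h3 : T ∘ₗ ρ g ∘ₗ s = σ g := by
    ext x
    simp [hT', hs']
  simp only [Pi.sub_apply, Representation.character]
  nth_rw 1 [h1]
  rw [map_add, ← LinearMap.comp_assoc, LinearMap.trace_comp_comm', h2,
    LinearMap.trace_comp_comm' T, h3, add_sub_cancel_right]

/-- The permutation representation of a `G`-set. -/
def permRep (G : Type*) [Group G] (Y : Type*) [MulAction G Y] : Representation ℂ G (Y →₀ ℂ) where
  toFun g := Finsupp.lmapDomain ℂ ℂ (g • ·)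
  map_one' := by ext; simp
  map_mul' a b := by ext; simp [mul_smul]

theorem permRep_single {Y : Type*} [MulAction G Y] (g : G) (y : Y) (c : ℂ) :
    permRep G Y g (Finsupp.single y c) = Finsupp.single (g • y) c := by
  simp [permRep]

theorem permRep_character {Y : Type*} [Finite Y] [MulAction G Y] (g : G) :
    (permRep G Y).character g = Nat.card {y : Y // g • y = y} := by
  classical
  have := Fintype.ofFinite Y
  rw [Representation.character, LinearMap.trace_eq_matrix_trace ℂ Finsupp.basisSingleOne,
    Matrix.trace, Nat.card_eq_fintype_card, Fintype.card_subtype, Finset.card_filter]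
  push_cast
  refine Finset.sum_congr rfl fun y _ => ?_
  simp [LinearMap.toMatrix_apply, permRep_single, Finsupp.single_apply]

/-- An equivariant partial map of `G`-sets which is onto induces an inequality between permutation
characters. -/
theorem effLE_permRep {Y W : Type*} [Finite Y] [Finite W] [MulAction G Y] [MulAction G W]
    (π : Y → Option W) (hπ : ∀ (g : G) y, π (g • y) = (π y).map (g • ·))
    (hs : ∀ w, ∃ y, π y = some w) :
    EffLE (permRep G W).character (permRep G Y).character := by
  refine effLE_of_surjective (permRep G Y) (permRep G W)
    -- Basis vectors on which `π` is undefined go to 0.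
    (Finsupp.linearCombination ℂ fun y => (π y).elim 0 fun w => Finsupp.single w 1) ?_ ?_
  · intro g
    ext1 y
    ext1
    simp only [LinearMap.coe_comp, Function.comp_apply, Finsupp.lsingle_apply, permRep_single,
      Finsupp.linearCombination_single, one_smul, hπ]
    cases π y <;> simp [permRep_single]
  · rw [← LinearMap.range_eq_top, eq_top_iff, ← Finsupp.basisSingleOne.span_eq,
      Submodule.span_le]
    rintro _ ⟨w, rfl⟩
    obtain ⟨y, hy⟩ := hs w
    exact ⟨Finsupp.single y 1, by simp [hy]⟩

/-- The real part of the average of a class function over a finite group. -/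
def groupAverage (G : Type*) [Group G] [Finite G] : (G → ℂ) →ₗ[ℝ] ℝ where
  toFun χ := (Nat.card G : ℝ)⁻¹ * ∑ᶠ g, (χ g).re
  map_add' χ ψ := by
    rw [← mul_add, ← finsum_add_distrib (Set.toFinite _) (Set.toFinite _)]
    simp
  map_smul' r χ := by
    have := Fintype.ofFinite G
    simp [finsum_eq_sum_of_fintype, Finset.mul_sum, mul_left_comm]

theorem groupAverage_apply [Fintype G] (χ : G → ℂ) :
    groupAverage G χ = (Nat.card G : ℝ)⁻¹ * ∑ g, (χ g).re := by
  simp [groupAverage, finsum_eq_sum_of_fintype]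

/-- The average of the character of a representation is the dimension of its invariants. -/
theorem IsEffective.groupAverage_nonneg [Finite G] {χ : G → ℂ} (h : IsEffective χ) :
    0 ≤ groupAverage G χ := by
  have := Fintype.ofFinite G
  obtain ⟨V, _, _, _, ρ, rfl⟩ := h
  have : Invertible (Nat.card G : ℂ) :=
    invertibleOfNonzero (by exact_mod_cast Nat.card_pos.ne')
  have h1 := congrArg Complex.re ρ.card_inv_mul_sum_char_eq_finrank
  have h2 : (((Nat.card G : ℂ)⁻¹ * ∑ g : G, ρ.character g)).re = groupAverage G ρ.character := by
    rw [groupAverage_apply]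
    have : ((Nat.card G : ℂ)⁻¹) = (((Nat.card G : ℝ)⁻¹ : ℝ) : ℂ) := by push_cast; rfl
    rw [this, Complex.re_ofReal_mul, Complex.re_sum]
  rw [← h2, h1, Complex.natCast_re]
  exact Nat.cast_nonneg _

theorem EffLE.groupAverage_le [Finite G] {χ ψ : G → ℂ} (h : EffLE χ ψ) :
    groupAverage G χ ≤ groupAverage G ψ := by
  have := h.sub.groupAverage_nonneg
  rwa [map_sub, sub_nonneg] at this

end Effective

/-! ### Splittings of structures -/

namespace HopfMonoid

variable {K : Type*} [Field K] {H : SetSpecies.{u, v}}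

section Basic

variable {M N L : Type u} [Finite M] [Finite N] [Finite L]

theorem vec_tmul_vec_tmul_vec_ne_zero (x : H.obj M) (y : H.obj N) (z : H.obj L) :
    H.vec K x ⊗ₜ[K] (H.vec K y ⊗ₜ[K] H.vec K z) ≠ 0 := by
  intro h
  have := congrArg (finsuppTensorFinsupp' K (H.obj M) (H.obj N × H.obj L) ∘
    TensorProduct.map LinearMap.id
      (finsuppTensorFinsupp' K (H.obj N) (H.obj L)).toLinearMap) h
  simp [SetSpecies.vec] at this

/-- Tensors of basis vectors are distinct basis vectors; this turns coassociativity of the linear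
maps into equalities of structures. -/
theorem vec_tmul_vec_tmul_vec_inj {x x' : H.obj M} {y y' : H.obj N} {z z' : H.obj L}
    (h : H.vec K x ⊗ₜ[K] (H.vec K y ⊗ₜ[K] H.vec K z) =
      H.vec K x' ⊗ₜ[K] (H.vec K y' ⊗ₜ[K] H.vec K z')) : x = x' ∧ y = y' ∧ z = z' := by
  have := congrArg (finsuppTensorFinsupp' K (H.obj M) (H.obj N × H.obj L) ∘
    TensorProduct.map LinearMap.id
      (finsuppTensorFinsupp' K (H.obj N) (H.obj L)).toLinearMap) h
  simpa [SetSpecies.vec, Finsupp.single_left_inj] using this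

theorem map_vec (e : M ≃ N) (x : H.obj M) :
    (H.linearization K).map e (H.vec K x) = H.vec K (H.map e x) := by
  simp [SetSpecies.linearization, SetSpecies.vec]

theorem lmapDomain_vec (e : M ≃ N) (x : H.obj M) :
    Finsupp.lmapDomain K K (H.map e) (H.vec K x) = H.vec K (H.map e x) :=
  map_vec e x

end Basic

variable (X : HopfMonoid (H.linearization K))

section Iso

variable {T U V W P Q T' U' V' : Type u} [Finite T] [Finite U] [Finite V] [Finite W] [Finite P]
  [Finite Q] [Finite T'] [Finite U'] [Finite V']

/-- The structure `t` splits into `u` and `v` along a bijection `e`. -/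
def SplitsAlong (e : T ≃ U ⊕ V) (t : H.obj T) (u : H.obj U) (v : H.obj V) : Prop :=
  X.comul U V (H.vec K (H.map e t)) = H.vec K u ⊗ₜ[K] H.vec K v

variable {X}

theorem comul_map_vec {t : H.obj (U ⊕ V)} {u : H.obj U} {v : H.obj V}
    (h : X.comul U V (H.vec K t) = H.vec K u ⊗ₜ[K] H.vec K v) (b : U ≃ U') (c : V ≃ V') :
    X.comul U' V' (H.vec K (H.map (Equiv.sumCongr b c) t)) =
      H.vec K (H.map b u) ⊗ₜ[K] H.vec K (H.map c v) := by
  have := LinearMap.congr_fun (X.comul_natural b c) (H.vec K t)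
  simp only [LinearMap.comp_apply, lmapDomain_vec, h, TensorProduct.map_tmul] at this
  exact this

theorem SplitsAlong.map {e : T ≃ U ⊕ V} {t : H.obj T} {u : H.obj U} {v : H.obj V}
    (h : X.SplitsAlong e t u v) (a : T ≃ T') (b : U ≃ U') (c : V ≃ V') :
    X.SplitsAlong (a.symm.trans (e.trans (Equiv.sumCongr b c))) (H.map a t) (H.map b u)
      (H.map c v) := by
  have := comul_map_vec h b c
  rw [← H.map_trans] at this
  rw [SplitsAlong, ← H.map_trans, ← this]
  congr 3
  ext x
  simp

/-- Coassociativity read on basis vectors. One bracketing of the iterated coproduct is a nonzero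
tensor of three structures, so the other cannot vanish at either stage. Being linearized, it is
again a tensor of three structures, and the factors agree. The hypothesis `hf` says that both
bracketings decompose `T` in the same way. -/
theorem SplitsAlong.assoc (hX : X.IsLinearized) {e : T ≃ P ⊕ W} {e' : P ≃ U ⊕ V}
    (f : T ≃ U ⊕ Q) (f' : Q ≃ V ⊕ W)
    (hf : (e.trans (Equiv.sumCongr e' (Equiv.refl W))).trans (Equiv.sumAssoc U V W) =
      f.trans (Equiv.sumCongr (Equiv.refl U) f'))
    {t : H.obj T} {p : H.obj P} {w : H.obj W} {u : H.obj U} {v : H.obj V}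
    (h : X.SplitsAlong e t p w) (h' : X.SplitsAlong e' p u v) :
    ∃ q, X.SplitsAlong f t u q ∧ X.SplitsAlong f' q v w := by
  have h1 := comul_map_vec h e' (Equiv.refl W)
  rw [← H.map_trans, H.map_refl] at h1
  have key := LinearMap.congr_fun (X.coassoc U V W)
    (H.vec K (H.map (e.trans (Equiv.sumCongr e' (Equiv.refl W))) t))
  unfold SplitsAlong at h'
  simp only [LinearMap.comp_apply, lmapDomain_vec, h1, TensorProduct.map_tmul, h',
    LinearEquiv.coe_coe, LinearMap.id_apply, TensorProduct.assoc_tmul, ← H.map_trans, hf] at key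
  obtain h0 | ⟨a, b, hab⟩ := hX.comul U (V ⊕ W)
    (H.map (f.trans (Equiv.sumCongr (Equiv.refl U) f')) t)
  · rw [h0, map_zero] at key
    exact absurd key (vec_tmul_vec_tmul_vec_ne_zero _ _ _)
  rw [hab, TensorProduct.map_tmul] at key
  obtain h0 | ⟨c, d, hcd⟩ := hX.comul V W b
  · rw [h0, TensorProduct.tmul_zero] at key
    exact absurd key (vec_tmul_vec_tmul_vec_ne_zero _ _ _)
  rw [hcd] at key
  obtain ⟨rfl, rfl, rfl⟩ := vec_tmul_vec_tmul_vec_inj key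
  have h2 := comul_map_vec hab (Equiv.refl U) f'.symm
  refine ⟨H.map f'.symm b, ?_, ?_⟩
  · rw [← H.map_trans, H.map_refl] at h2
    rw [SplitsAlong, ← h2]
    congr 3
    ext x
    simp only [Equiv.trans_apply]
    cases f x <;> simp
  · rw [SplitsAlong, ← H.map_trans, Equiv.symm_trans_self, H.map_refl, hcd]

theorem SplitsAlong.assoc_symm (hX : X.IsLinearized) {f : T ≃ U ⊕ Q} {f' : Q ≃ V ⊕ W}
    (e : T ≃ P ⊕ W) (e' : P ≃ U ⊕ V)
    (hf : (e.trans (Equiv.sumCongr e' (Equiv.refl W))).trans (Equiv.sumAssoc U V W) =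
      f.trans (Equiv.sumCongr (Equiv.refl U) f'))
    {t : H.obj T} {q : H.obj Q} {w : H.obj W} {u : H.obj U} {v : H.obj V}
    (h : X.SplitsAlong f t u q) (h' : X.SplitsAlong f' q v w) :
    ∃ p, X.SplitsAlong e t p w ∧ X.SplitsAlong e' p u v := by
  have h1 := comul_map_vec h (Equiv.refl U) f'
  rw [← H.map_trans, H.map_refl] at h1
  have key := LinearMap.congr_fun (X.coassoc U V W)
    (H.vec K (H.map (e.trans (Equiv.sumCongr e' (Equiv.refl W))) t))
  unfold SplitsAlong at h'
  simp only [LinearMap.comp_apply, lmapDomain_vec, ← H.map_trans, hf] at key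
  simp only [h1, TensorProduct.map_tmul, h', LinearMap.id_apply, LinearEquiv.coe_coe] at key
  obtain h0 | ⟨a, b, hab⟩ := hX.comul (U ⊕ V) W
    (H.map (e.trans (Equiv.sumCongr e' (Equiv.refl W))) t)
  · rw [h0, map_zero, map_zero] at key
    exact absurd key.symm (vec_tmul_vec_tmul_vec_ne_zero _ _ _)
  rw [hab, TensorProduct.map_tmul] at key
  obtain h0 | ⟨c, d, hcd⟩ := hX.comul U V a
  · rw [h0, TensorProduct.zero_tmul, map_zero] at key
    exact absurd key.symm (vec_tmul_vec_tmul_vec_ne_zero _ _ _)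
  rw [hcd, TensorProduct.assoc_tmul] at key
  obtain ⟨rfl, rfl, rfl⟩ := vec_tmul_vec_tmul_vec_inj key
  have h2 := comul_map_vec hab e'.symm (Equiv.refl W)
  refine ⟨H.map e'.symm a, ?_, ?_⟩
  · rw [← H.map_trans, H.map_refl] at h2
    rw [SplitsAlong]
    refine Eq.trans ?_ h2
    congr 3
    ext x
    simp only [Equiv.trans_apply]
    cases e x <;> simp
  · rw [SplitsAlong, ← H.map_trans, Equiv.symm_trans_self, H.map_refl, hcd]

end Iso

/-! ### Structures on the subsets of a finite set -/

/-- A structure on a subset of `N`. -/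
abbrev Piece (H : SetSpecies.{u, v}) (N : Type u) [Finite N] : Type (max u v) :=
  Σ W : Set N, H.obj ↥W

variable {N : Type u} [Finite N]

/-- The structure `t` on a subset of `N` splits into `u` and `v`, on complementary subsets. -/
def PieceSplits (t u v : Piece H N) : Prop :=
  ∃ e : ↥t.1 ≃ ↥u.1 ⊕ ↥v.1, (∀ x, (e.symm (.inl x) : N) = x) ∧ (∀ x, (e.symm (.inr x) : N) = x) ∧
    X.SplitsAlong e t.2 u.2 v.2

variable {X}

theorem PieceSplits.union {t u v : Piece H N} (h : X.PieceSplits t u v) : t.1 = u.1 ∪ v.1 := by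
  obtain ⟨e, h1, h2, -⟩ := h
  ext x
  constructor
  · intro hx
    cases hy : e ⟨x, hx⟩ with
    | inl y =>
      left
      have := h1 y
      rw [← hy, e.symm_apply_apply] at this
      exact (show x = y from this) ▸ y.2
    | inr y =>
      right
      have := h2 y
      rw [← hy, e.symm_apply_apply] at this
      exact (show x = y from this) ▸ y.2
  · rintro (hx | hx)
    · have := (e.symm (.inl ⟨x, hx⟩)).2
      rwa [h1] at this
    · have := (e.symm (.inr ⟨x, hx⟩)).2
      rwa [h2] at this

theorem PieceSplits.disjoint {t u v : Piece H N} (h : X.PieceSplits t u v) :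
    Disjoint u.1 v.1 := by
  obtain ⟨e, h1, h2, -⟩ := h
  rw [Set.disjoint_left]
  intro x hx hx'
  have : e.symm (.inl ⟨x, hx⟩) = e.symm (.inr ⟨x, hx'⟩) := Subtype.ext (by rw [h1, h2])
  simpa using e.symm.injective this

omit [Finite N] in
/-- The canonical bijection from a disjoint union of subsets to their sum. -/
theorem exists_splitEquiv {T U V : Set N} (hT : T = U ∪ V) (hd : Disjoint U V) :
    ∃ e : ↥T ≃ ↥U ⊕ ↥V, (∀ x, (e.symm (.inl x) : N) = x) ∧ ∀ x, (e.symm (.inr x) : N) = x := by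
  classical
  subst hT
  exact ⟨Equiv.Set.union hd, fun x => by simp, fun x => by simp⟩

-- The inverses of all these bijections are inclusions inside `N`, so the compatibility needed for
-- coassociativity is automatic. This is the gain from working with subsets of one fixed set.
omit [Finite N] in
theorem assocEquiv_eq {T U V W P Q : Set N} {e : ↥T ≃ ↥P ⊕ ↥W} {e' : ↥P ≃ ↥U ⊕ ↥V}
    {f : ↥T ≃ ↥U ⊕ ↥Q} {f' : ↥Q ≃ ↥V ⊕ ↥W}
    (h1 : ∀ x, (e.symm (.inl x) : N) = x) (h2 : ∀ x, (e.symm (.inr x) : N) = x)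
    (h1' : ∀ x, (e'.symm (.inl x) : N) = x) (h2' : ∀ x, (e'.symm (.inr x) : N) = x)
    (k1 : ∀ x, (f.symm (.inl x) : N) = x) (k2 : ∀ x, (f.symm (.inr x) : N) = x)
    (k1' : ∀ x, (f'.symm (.inl x) : N) = x) (k2' : ∀ x, (f'.symm (.inr x) : N) = x) :
    (e.trans (Equiv.sumCongr e' (Equiv.refl W))).trans (Equiv.sumAssoc U V W) =
      f.trans (Equiv.sumCongr (Equiv.refl U) f') := by
  rw [← Equiv.symm_bijective.injective.eq_iff]
  ext (x | x | x) <;> simp [*]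

theorem PieceSplits.assoc (hX : X.IsLinearized) {t p u v w : Piece H N}
    (h : X.PieceSplits t p w) (h' : X.PieceSplits p u v) :
    ∃ q, X.PieceSplits t u q ∧ X.PieceSplits q v w := by
  have hT := h.union
  have hP := h'.union
  have hd := h.disjoint
  have hd' := h'.disjoint
  rw [hP, Set.disjoint_union_left] at hd
  rw [hP, Set.union_assoc] at hT
  obtain ⟨e, h1, h2, h⟩ := h
  obtain ⟨e', h1', h2', h'⟩ := h'
  obtain ⟨f, k1, k2⟩ := exists_splitEquiv hT (Set.disjoint_union_right.2 ⟨hd', hd.1⟩)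
  obtain ⟨f', k1', k2'⟩ := exists_splitEquiv rfl hd.2
  obtain ⟨q, hq, hq'⟩ := h.assoc hX f f' (assocEquiv_eq h1 h2 h1' h2' k1 k2 k1' k2') h'
  exact ⟨⟨_, q⟩, ⟨f, k1, k2, hq⟩, ⟨f', k1', k2', hq'⟩⟩

theorem PieceSplits.assoc_symm (hX : X.IsLinearized) {t q u v w : Piece H N}
    (h : X.PieceSplits t u q) (h' : X.PieceSplits q v w) :
    ∃ p, X.PieceSplits t p w ∧ X.PieceSplits p u v := by
  have hT := h.union
  have hQ := h'.union
  have hd := h.disjoint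
  have hd' := h'.disjoint
  rw [hQ, Set.disjoint_union_right] at hd
  rw [hQ, ← Set.union_assoc] at hT
  obtain ⟨f, k1, k2, h⟩ := h
  obtain ⟨f', k1', k2', h'⟩ := h'
  obtain ⟨e, h1, h2⟩ := exists_splitEquiv hT (Set.disjoint_union_left.2 ⟨hd.2, hd'⟩)
  obtain ⟨e', h1', h2'⟩ := exists_splitEquiv rfl hd.1
  obtain ⟨p, hp, hp'⟩ := h.assoc_symm hX e e' (assocEquiv_eq h1 h2 h1' h2' k1 k2 k1' k2') h'
  exact ⟨⟨_, p⟩, ⟨e, h1, h2, hp⟩, ⟨e', h1', h2', hp'⟩⟩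

/-- The bijection from the sum of a subset and its complement to the whole set. -/
def sumComplEquiv (S : Set N) : ↥S ⊕ ↥Sᶜ ≃ N :=
  letI : DecidablePred (· ∈ S) := Classical.decPred _
  Equiv.Set.sumCompl S

omit [Finite N] in
@[simp]
theorem sumComplEquiv_inl (S : Set N) (x : ↥S) : sumComplEquiv S (.inl x) = x := rfl

omit [Finite N] in
@[simp]
theorem sumComplEquiv_inr (S : Set N) (x : ↥Sᶜ) : sumComplEquiv S (.inr x) = x := rfl

theorem comulAt_vec (S : Set N) (h : H.obj N) :
    X.comulAt S (H.vec K h) = X.comul ↥S ↥Sᶜ (H.vec K (H.map (sumComplEquiv S).symm h)) := by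
  rw [comulAt, LinearMap.comp_apply, map_vec]
  rfl

theorem splits_iff_splitsAlong {h : H.obj N} {S : Set N} {x : H.obj ↥S} {y : H.obj ↥Sᶜ} :
    X.Splits h S x y ↔ X.SplitsAlong (sumComplEquiv S).symm h x y := by
  rw [Splits, comulAt_vec, SplitsAlong]

/-- The image of a piece of a piece. -/
def Piece.ofSubset {W : Set N} {S : Set ↥W} (x : H.obj ↥S) : Piece H N :=
  ⟨Subtype.val '' S, H.map (Equiv.Set.image Subtype.val S Subtype.val_injective) x⟩

theorem SplitsAlong.pieceSplits {T U V : Type u} [Finite T] [Finite U] [Finite V]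
    {e : T ≃ U ⊕ V} {t : H.obj T} {x : H.obj U} {y : H.obj V} (h : X.SplitsAlong e t x y)
    {W U' V' : Set N} (a : T ≃ ↥W) (b : U ≃ ↥U') (c : V ≃ ↥V')
    (hb : ∀ x, (a (e.symm (.inl x)) : N) = b x) (hc : ∀ x, (a (e.symm (.inr x)) : N) = c x) :
    X.PieceSplits ⟨W, H.map a t⟩ ⟨U', H.map b x⟩ ⟨V', H.map c y⟩ := by
  refine ⟨_, fun x => ?_, fun x => ?_, h.map a b c⟩
  · obtain ⟨y, rfl⟩ := b.surjective x
    simp [hb]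
  · obtain ⟨y, rfl⟩ := c.surjective x
    simp [hc]

theorem Splits.pieceSplits {W : Set N} {t : H.obj ↥W} {S : Set ↥W} {x : H.obj ↥S}
    {y : H.obj ↥Sᶜ} (h : X.Splits t S x y) :
    X.PieceSplits ⟨W, t⟩ (Piece.ofSubset x) (Piece.ofSubset y) := by
  rw [splits_iff_splitsAlong] at h
  have := h.pieceSplits (Equiv.refl ↥W) (Equiv.Set.image Subtype.val S Subtype.val_injective)
    (Equiv.Set.image Subtype.val Sᶜ Subtype.val_injective) (fun _ => rfl) (fun _ => rfl)
  rwa [H.map_refl] at this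

/-- The way back from pieces to `Splits`, in which convexity and minors are phrased; `e₀` lets the
total structure live on any type identified with a subset of `N`. -/
theorem PieceSplits.splits {T : Type u} [Finite T] {W : Set N} {t : H.obj T} {u v : Piece H N}
    (e₀ : T ≃ ↥W) (h : X.PieceSplits ⟨W, H.map e₀ t⟩ u v) :
    ∃ (a : ↥u.1 ≃ ↥{x | (e₀ x : N) ∈ u.1}) (b : ↥v.1 ≃ ↥{x | (e₀ x : N) ∈ u.1}ᶜ),
      (∀ x, (a.symm x : N) = e₀ x) ∧
      X.Splits t {x | (e₀ x : N) ∈ u.1} (H.map a u.2) (H.map b v.2) := by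
  have hT := h.union
  have hd := h.disjoint
  obtain ⟨e, h1, h2, h⟩ := h
  dsimp only at hT
  let a : ↥u.1 ≃ ↥{x | (e₀ x : N) ∈ u.1} :=
    { toFun := fun x => ⟨e₀.symm ⟨x, hT ▸ Or.inl x.2⟩, by simp⟩
      invFun := fun x => ⟨e₀ x.1, x.2⟩
      left_inv := fun x => by simp
      right_inv := fun x => by simp }
  let b : ↥v.1 ≃ ↥{x | (e₀ x : N) ∈ u.1}ᶜ :=
    { toFun := fun x => ⟨e₀.symm ⟨x, hT ▸ Or.inr x.2⟩, by
        simpa using fun hx => Set.disjoint_left.1 hd hx x.2⟩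
      invFun := fun x => ⟨e₀ x.1, (show (e₀ x : N) ∈ u.1 ∪ v.1 from
        hT.subset (e₀ x.1).2).resolve_left x.2⟩
      left_inv := fun x => by simp
      right_inv := fun x => by simp }
  refine ⟨a, b, fun x => rfl, ?_⟩
  rw [splits_iff_splitsAlong]
  have := h.map e₀.symm a b
  dsimp only at this
  rw [← H.map_trans, Equiv.self_trans_symm, H.map_refl] at this
  convert this using 1
  apply Equiv.symm_bijective.injective
  ext (x | x)
  · obtain ⟨x, rfl⟩ := a.surjective x
    apply e₀.injective
    apply Subtype.ext
    simp [h1]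
    simp [a]
  · obtain ⟨x, rfl⟩ := b.surjective x
    apply e₀.injective
    apply Subtype.ext
    simp [h2]
    simp [b]

/-- The value of a character at a piece. -/
def Character.pieceVal (φ : X.Character) (t : Piece H N) : K := φ.val t.2

theorem Character.val_map (φ : X.Character) {M N : Type u} [Finite M] [Finite N] (e : M ≃ N)
    (x : H.obj M) : φ.val (H.map e x) = φ.val x := by
  rw [val, ← map_vec, φ.natural]
  rfl

theorem PieceSplits.pieceVal {φ : X.Character} (hφ : φ.IsBalancedConvex) {t u v : Piece H N}
    (h : X.PieceSplits t u v) (ht : φ.pieceVal t = 1) : φ.pieceVal u = 1 ∧ φ.pieceVal v = 1 := by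
  obtain ⟨W, t⟩ := t
  rw [← H.map_refl _ t] at h
  obtain ⟨a, b, -, hs⟩ := h.splits (Equiv.refl ↥W)
  have := hφ.convex _ _ ht _ _ _ hs
  rwa [φ.val_map, φ.val_map] at this

theorem exists_pieceSplits (hX : X.IsLinearized) {φ : X.Character} (hφ : φ.IsBalancedConvex)
    (t : Piece H N) (ht : 1 < t.1.ncard) :
    ∃ u v, X.PieceSplits t u v ∧ u.1.Nonempty ∧ v.1.Nonempty := by
  obtain ⟨W, t⟩ := t
  obtain ⟨S, h1, h2, h3⟩ := hφ.decomposable ↥W t ht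
  have : ∃ x y, X.Splits t S x y := by
    simp only [Splits]
    rw [comulAt_vec] at h3 ⊢
    exact (hX.comul _ _ _).resolve_left h3
  obtain ⟨x, y, h⟩ := this
  refine ⟨_, _, h.pieceSplits, h1.image _, ?_⟩
  exact (Set.nonempty_compl.2 h2).image _

/-- If the unit were 0, the unit law would annihilate the space on the empty set, which has
dimension 1. -/
theorem unit_ne_zero (X : HopfMonoid (H.linearization K)) : X.one ≠ 0 := by
  intro h
  have := X.connected
  have h1 : Subsingleton ((H.linearization K).obj PEmpty.{u + 1}) := by
    refine subsingleton_of_forall_eq 0 fun x => ?_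
    have := X.one_mul PEmpty.{u + 1} x
    rw [h, TensorProduct.zero_tmul, map_zero, map_zero] at this
    exact this.symm
  rw [Module.finrank_zero_of_subsingleton] at this
  exact zero_ne_one this

/-! ### Splitting off the empty set -/

section Unit

variable {T : Type u} [Finite T]

/-- The counit law gives the coproduct as `one ⊗ t`, but `one` is not assumed to be a structure.
Comparing coefficients on pairs of structures excludes a zero coproduct, as `one ≠ 0`, and forces
the second factor to be `t`. -/
theorem exists_splitsAlong_emptySum (hX : X.IsLinearized) (t : H.obj T) :
    ∃ o, X.SplitsAlong (Equiv.emptySum PEmpty.{u + 1} T).symm t o t := by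
  have h := X.counit_left T (H.vec K t)
  rw [map_vec] at h
  obtain h0 | ⟨x, y, h'⟩ := hX.comul PEmpty.{u + 1} T (H.map (Equiv.emptySum PEmpty T).symm t)
  all_goals
    rw [‹X.comul _ _ _ = _›] at h
    have key := congrArg (finsuppTensorFinsupp' K (H.obj PEmpty.{u + 1}) (H.obj T)) h
  · obtain ⟨a, ha⟩ := Finsupp.ne_iff.1 X.unit_ne_zero
    have := DFunLike.congr_fun key (a, t)
    simp [SetSpecies.vec] at this
    exact absurd this ha.symm
  · have := DFunLike.congr_fun key (x, y)
    have hy : y = t := by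
      by_contra hy
      simp [SetSpecies.vec, Finsupp.single_eq_of_ne hy] at this
    exact ⟨x, hy ▸ h'⟩

theorem exists_splitsAlong_sumEmpty (hX : X.IsLinearized) (t : H.obj T) :
    ∃ o, X.SplitsAlong (Equiv.sumEmpty T PEmpty.{u + 1}).symm t t o := by
  have h := X.counit_right T (H.vec K t)
  rw [map_vec] at h
  obtain h0 | ⟨y, x, h'⟩ := hX.comul T PEmpty.{u + 1} (H.map (Equiv.sumEmpty T PEmpty).symm t)
  all_goals
    rw [‹X.comul _ _ _ = _›] at h
    have key := congrArg (finsuppTensorFinsupp' K (H.obj T) (H.obj PEmpty.{u + 1})) h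
  · obtain ⟨a, ha⟩ := Finsupp.ne_iff.1 X.unit_ne_zero
    have := DFunLike.congr_fun key (t, a)
    simp [SetSpecies.vec] at this
    exact absurd this ha.symm
  · have := DFunLike.congr_fun key (y, x)
    have hy : y = t := by
      by_contra hy
      simp [SetSpecies.vec, Finsupp.single_eq_of_ne hy] at this
    exact ⟨x, hy ▸ h'⟩

end Unit

theorem exists_pieceSplits_empty_left (hX : X.IsLinearized) (t : Piece H N) :
    ∃ o : Piece H N, o.1 = ∅ ∧ X.PieceSplits t o t := by
  obtain ⟨W, t⟩ := t
  obtain ⟨o, ho⟩ := exists_splitsAlong_emptySum hX t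
  have := ho.pieceSplits (N := N) (Equiv.refl ↥W) (Equiv.equivOfIsEmpty _ ↥(∅ : Set N))
    (Equiv.refl ↥W) (fun x => x.elim) (fun x => rfl)
  rw [H.map_refl] at this
  exact ⟨_, rfl, this⟩

theorem exists_pieceSplits_empty_right (hX : X.IsLinearized) (t : Piece H N) :
    ∃ o : Piece H N, o.1 = ∅ ∧ X.PieceSplits t t o := by
  obtain ⟨W, t⟩ := t
  obtain ⟨o, ho⟩ := exists_splitsAlong_sumEmpty hX t
  have := ho.pieceSplits (N := N) (Equiv.refl ↥W) (Equiv.refl ↥W)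
    (Equiv.equivOfIsEmpty _ ↥(∅ : Set N)) (fun x => rfl) (fun x => x.elim)
  rw [H.map_refl] at this
  exact ⟨_, rfl, this⟩

/-! ### Intervals of a structure -/

variable (X) in
/-- The piece `z` is the minor `(t|_B)/A` of the piece `t`. -/
def PieceMinor (t : Piece H N) (A B : Set N) (z : Piece H N) : Prop :=
  ∃ x y w, X.PieceSplits t x y ∧ X.PieceSplits x w z ∧ w.1 = A ∧ x.1 = B

theorem PieceMinor.eq_diff {t z : Piece H N} {A B : Set N} (h : X.PieceMinor t A B z) :
    z.1 = B \ A := by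
  obtain ⟨x, y, w, -, h, rfl, rfl⟩ := h
  rw [h.union, Set.union_sdiff_cancel_left]
  exact h.disjoint.le_bot

/-- Coassociativity moves the cut of `z` at `B'` to a cut of `t` at `A ∪ B'`, and then the cut at
`A'` to one at `A ∪ A'`. -/
theorem PieceMinor.trans (hX : X.IsLinearized) {t z s : Piece H N} {A B A' B' : Set N}
    (h : X.PieceMinor t A B z) (h' : X.PieceMinor z A' B' s) :
    X.PieceMinor t (A ∪ A') (A ∪ B') s := by
  obtain ⟨x, y, w, h1, h2, rfl, rfl⟩ := h
  obtain ⟨p, q, r, h3, h4, rfl, rfl⟩ := h'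
  obtain ⟨x', hx', hw⟩ := h2.assoc_symm hX h3
  obtain ⟨y', hy', -⟩ := h1.assoc hX hx'
  obtain ⟨w', hw', hw''⟩ := hw.assoc_symm hX h4
  exact ⟨x', y', w', hy', hw', hw''.union, hw.union⟩

theorem PieceMinor.pieceVal {φ : X.Character} (hφ : φ.IsBalancedConvex) {t z : Piece H N}
    {A B : Set N} (h : X.PieceMinor t A B z) (ht : φ.pieceVal t = 1) : φ.pieceVal z = 1 := by
  obtain ⟨x, y, w, h1, h2, -, -⟩ := h
  exact (h2.pieceVal hφ (h1.pieceVal hφ ht).1).2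

theorem PieceSplits.minor_left (hX : X.IsLinearized) {t u v : Piece H N}
    (h : X.PieceSplits t u v) : X.PieceMinor t ∅ u.1 u := by
  obtain ⟨o, ho, h'⟩ := exists_pieceSplits_empty_left hX u
  exact ⟨u, v, o, h, h', ho, rfl⟩

theorem PieceSplits.minor_right (hX : X.IsLinearized) {t u v : Piece H N}
    (h : X.PieceSplits t u v) : X.PieceMinor t u.1 t.1 v := by
  obtain ⟨o, ho, h'⟩ := exists_pieceSplits_empty_right hX t
  exact ⟨t, o, u, h', h, rfl, rfl⟩

theorem pieceMinor_self (hX : X.IsLinearized) (t : Piece H N) : X.PieceMinor t ∅ t.1 t := by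
  obtain ⟨o, ho, h'⟩ := exists_pieceSplits_empty_left hX t
  simpa [ho] using h'.minor_right hX

/-- A piece with at least two points splits off a single point on the right. -/
theorem exists_pieceSplits_ncard_one (hX : X.IsLinearized) {φ : X.Character}
    (hφ : φ.IsBalancedConvex) (t : Piece H N) (ht : t.1.Nonempty) :
    ∃ u v, X.PieceSplits t u v ∧ v.1.ncard = 1 := by
  obtain ⟨m, hm⟩ : ∃ m, t.1.ncard = m := ⟨_, rfl⟩
  induction m using Nat.strong_induction_on generalizing t with
  | _ m ih =>
    by_cases h1 : t.1.ncard ≤ 1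
    · obtain ⟨o, ho, h⟩ := exists_pieceSplits_empty_left hX t
      exact ⟨o, t, h, le_antisymm h1 ((Set.ncard_pos (Set.toFinite _)).2 ht)⟩
    -- The right factor is smaller, so a point splits off on its right; regrouping absorbs the rest
    -- into the left factor.
    · obtain ⟨u, v, h, hu, hv⟩ := exists_pieceSplits hX hφ t (not_le.1 h1)
      have hlt : v.1.ncard < m := by
        rw [← hm, h.union, Set.ncard_union_eq h.disjoint]
        exact Nat.lt_add_of_pos_left ((Set.ncard_pos (Set.toFinite _)).2 hu)
      obtain ⟨u', v', h', hv'⟩ := ih _ hlt v hv rfl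
      obtain ⟨p, hp, -⟩ := h.assoc_symm hX h'
      exact ⟨p, v', hp, hv'⟩

/-- Every piece has a linear order all of whose intervals are minors. -/
theorem exists_flag (hX : X.IsLinearized) {φ : X.Character} (hφ : φ.IsBalancedConvex) (m : ℕ)
    (t : Piece H N) (ht : t.1.ncard = m) :
    ∃ r : N → ℕ, Set.BijOn r t.1 (Set.Iio m) ∧ ∀ a b, a ≤ b → b ≤ m →
      ∃ z, X.PieceMinor t {x ∈ t.1 | r x < a} {x ∈ t.1 | r x < b} z := by
  induction m generalizing t with
  | zero =>
    rw [Set.ncard_eq_zero] at ht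
    refine ⟨fun _ => 0, by simp [ht], fun a b _ _ => ⟨t, ?_⟩⟩
    simpa [ht] using pieceMinor_self hX t
  | succ m ih =>
    have hne : t.1.Nonempty := Set.nonempty_of_ncard_ne_zero (by omega)
    obtain ⟨u, v, h, hv⟩ := exists_pieceSplits_ncard_one hX hφ t hne
    have hu : u.1.ncard = m := by
      have := h.union ▸ Set.ncard_union_eq h.disjoint
      omega
    obtain ⟨r, hr, hmin⟩ := ih u hu
    obtain ⟨p, hp⟩ := Set.ncard_eq_one.1 hv
    have hT := h.union
    have hd := h.disjoint
    rw [hp] at hT hd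
    have hpu : p ∉ u.1 := fun hx => Set.disjoint_left.1 hd hx rfl
    classical
    have hset : ∀ a ≤ m, {x ∈ t.1 | Function.update r p m x < a} = {x ∈ u.1 | r x < a} := by
      intro a ha
      ext x
      by_cases hx : x = p
      · subst hx
        simp [hpu, ha]
      · simp [hT, hx]
    have hset' : {x ∈ t.1 | Function.update r p m x < m + 1} = t.1 := by
      ext x
      simp only [Set.mem_ofPred_eq, and_iff_left_iff_imp]
      intro hx
      by_cases hxp : x = p
      · subst hxp
        simp
      · have : x ∈ u.1 := by simpa [hT, hxp] using hx
        have := hr.mapsTo this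
        simp only [Set.mem_Iio] at this
        simp [hxp]
        omega
    refine ⟨Function.update r p m, ?_, fun a b hab hb => ?_⟩
    · have h1 : Set.BijOn (Function.update r p m) u.1 (Set.Iio m) :=
        hr.congr fun x hx => by
          rw [Function.update_of_ne]
          rintro rfl
          exact hpu hx
      have h2 := h1.insert (a := p) (by simp)
      rw [Function.update_self, Set.Iio_insert] at h2
      rw [hT, Set.union_singleton]
      convert h2 using 1
      ext
      simp
    · obtain hb | rfl := Nat.le_succ_iff.1 hb
      · rw [hset a (hab.trans hb), hset b hb]
        obtain ⟨z, hz⟩ := hmin a b hab hb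
        refine ⟨z, ?_⟩
        simpa using (h.minor_left hX).trans hX hz
      · rw [Nat.succ_eq_add_one, hset']
        obtain ha | rfl := Nat.le_succ_iff.1 hab
        -- Only the initial segment `x` of `u` is kept from this minor. By coassociativity it is
        -- also an initial segment of `t`, and the quotient of `t` by it is the required interval.
        · rw [hset a ha]
          obtain ⟨z, x, y, w, h3, h4, h5, h6⟩ := hmin 0 a (Nat.zero_le _) ha
          obtain ⟨y', h7, -⟩ := h.assoc hX h3
          exact ⟨y', h6 ▸ h7.minor_right hX⟩
        · rw [Nat.succ_eq_add_one, hset']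
          obtain ⟨o, ho, h'⟩ := exists_pieceSplits_empty_right hX t
          exact ⟨o, h'.minor_right hX⟩

end HopfMonoid

namespace HopfMonoid

variable {K : Type*} [Field K] {H : SetSpecies.{u, v}} {X : HopfMonoid (H.linearization K)}
variable {N : Type u} [Finite N]

/-! ### Good intervals of a structure -/

/-- A structure on `N`, as a piece. -/
def Piece.top (h : H.obj N) : Piece H N :=
  ⟨Set.univ, H.map (Equiv.Set.univ N).symm h⟩

/-- The minor `(h|_B)/A` is defined, and the character `φ` takes the value `1` on it. -/
def Character.Good (φ : X.Character) (h : H.obj N) (A B : Set N) : Prop :=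
  ∃ z, X.PieceMinor (Piece.top h) A B z ∧ φ.pieceVal z = 1

theorem Piece.ext_map {T : Type u} [Finite T] (t : H.obj T) {W W' : Set N} (hW : W = W')
    (e : T ≃ ↥W) (e' : T ≃ ↥W') (h : ∀ x, (e x : N) = e' x) :
    (⟨W, H.map e t⟩ : Piece H N) = ⟨W', H.map e' t⟩ := by
  subst hW
  obtain rfl : e = e' := by
    ext x
    exact h x
  rfl

theorem Character.exists_isMinor_iff (φ : X.Character) (h : H.obj N) {A B : Set N} (hAB : A ⊆ B) :
    (∃ z, X.IsMinor h A B z ∧ φ.val z = 1) ↔ φ.Good h A B := by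
  constructor
  · rintro ⟨z, ⟨x, y, w, h1, h2⟩, hz⟩
    rw [splits_iff_splitsAlong] at h1
    have h3 := h1.pieceSplits (Equiv.Set.univ N).symm (Equiv.refl ↥B) (Equiv.refl ↥Bᶜ)
      (fun x => rfl) (fun x => rfl)
    rw [H.map_refl] at h3
    refine ⟨_, ⟨_, _, _, h3, h2.pieceSplits, ?_, rfl⟩, (φ.val_map _ z).trans hz⟩
    ext x
    simpa [Piece.ofSubset] using fun hx => hAB hx
  · rintro ⟨⟨Z, z⟩, ⟨⟨B, x⟩, ⟨Y, y⟩, w, h1, h2, rfl, rfl⟩, hz⟩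
    obtain ⟨a, b, hab, h3⟩ := h1.splits (Equiv.Set.univ N).symm
    rw [show x = H.map a.symm (H.map a x) by
      rw [← H.map_trans, Equiv.self_trans_symm, H.map_refl]] at h2
    obtain ⟨c, d, hcd, h4⟩ := h2.splits a.symm
    -- The types of `w'` and `z'` depend on the set rewritten next, so both are bound existentially.
    have h5 : ∃ w' z', X.Splits (H.map a x) {x | (a.symm x : N) ∈ w.1} w' z' ∧ φ.val z' = 1 :=
      ⟨_, _, h4, (φ.val_map _ z).trans hz⟩
    have hset : {x | (a.symm x : N) ∈ w.1} =
        {x : ↥{x : N | ((Equiv.Set.univ N).symm x : N) ∈ B} | (x : N) ∈ w.1} := by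
      ext x
      rw [Set.mem_ofPred_eq, hab]
      rfl
    rw [hset] at h5
    obtain ⟨w', z', h5, hz'⟩ := h5
    exact ⟨z', ⟨_, _, _, h3, h5⟩, hz'⟩

/-- Colorings are proper if the intervals between consecutive sublevel sets are good. -/
def Character.ProperMap (φ : X.Character) (h : H.obj N) {T : Type*} [LinearOrder T]
    (f : N → T) : Prop :=
  ∀ v, φ.Good h {w | f w < f v} {w | f w ≤ f v}

theorem Character.isProper_iff (φ : X.Character) (h : H.obj N) (f : N → ℕ+) :
    φ.IsProper h f ↔ φ.ProperMap h f := by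
  simp only [IsProper, ProperMap, Set.forall_mem_range]
  exact forall_congr' fun v => φ.exists_isMinor_iff h fun w hw => (show f w < f v from hw).le

theorem Character.properMap_comp_iff (φ : X.Character) (h : H.obj N) {T T' : Type*}
    [LinearOrder T] [LinearOrder T'] {i : T → T'} (hi : StrictMono i) (f : N → T) :
    φ.ProperMap h (i ∘ f) ↔ φ.ProperMap h f := by
  simp [ProperMap, hi.lt_iff_lt, hi.le_iff_le]

/-- The image of a piece under a permutation. -/
def Piece.perm (g : Equiv.Perm N) (t : Piece H N) : Piece H N :=
  ⟨g '' t.1, H.map (Equiv.image g t.1) t.2⟩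

theorem PieceSplits.perm {t u v : Piece H N} (h : X.PieceSplits t u v) (g : Equiv.Perm N) :
    X.PieceSplits (t.perm g) (u.perm g) (v.perm g) := by
  obtain ⟨e, h1, h2, h⟩ := h
  exact h.pieceSplits (Equiv.image g t.1) (Equiv.image g u.1) (Equiv.image g v.1)
    (fun x => congrArg g (h1 x)) (fun x => congrArg g (h2 x))

theorem Piece.perm_top {h : H.obj N} {g : Equiv.Perm N} (hg : g ∈ H.aut h) :
    (Piece.top h).perm g = Piece.top h := by
  have hg : H.map g h = h := hg
  rw [perm, top]
  dsimp only
  conv_rhs => rw [← hg]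
  rw [← H.map_trans, ← H.map_trans]
  exact Piece.ext_map h (by simp) _ _ fun x => rfl

theorem Character.Good.perm {φ : X.Character} {h : H.obj N} {A B : Set N} (hAB : φ.Good h A B)
    {g : Equiv.Perm N} (hg : g ∈ H.aut h) : φ.Good h (g '' A) (g '' B) := by
  obtain ⟨z, ⟨x, y, w, h1, h2, rfl, rfl⟩, hz⟩ := hAB
  have h3 := h1.perm g
  rw [Piece.perm_top hg] at h3
  exact ⟨_, ⟨_, _, _, h3, h2.perm g, rfl, rfl⟩, (φ.val_map _ z.2).trans hz⟩

theorem Character.ProperMap.perm {φ : X.Character} {h : H.obj N} {T : Type*} [LinearOrder T]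
    {f : N → T} (hf : φ.ProperMap h f) {g : Equiv.Perm N} (hg : g ∈ H.aut h) :
    φ.ProperMap h (f ∘ ⇑g⁻¹) := by
  intro v
  have := (hf (g⁻¹ v)).perm hg
  simp only [Equiv.image_eq_preimage_symm] at this
  exact this

/-- A good interval has a linear order all of whose subintervals are good. -/
theorem Character.Good.exists_flag (hX : X.IsLinearized) {φ : X.Character}
    (hφ : φ.IsBalancedConvex) {h : H.obj N} {A B : Set N} (hAB : φ.Good h A B) :
    ∃ r : N → ℕ, Set.BijOn r (B \ A) (Set.Iio (B \ A).ncard) ∧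
      ∀ a b, a ≤ b → b ≤ (B \ A).ncard →
        φ.Good h (A ∪ {x ∈ B \ A | r x < a}) (A ∪ {x ∈ B \ A | r x < b}) := by
  obtain ⟨z, hz, hz1⟩ := hAB
  rw [← hz.eq_diff]
  obtain ⟨r, hr, H1⟩ := HopfMonoid.exists_flag hX hφ _ z rfl
  refine ⟨r, hr, fun a b hab hb => ?_⟩
  obtain ⟨s, hs⟩ := H1 a b hab hb
  -- Convexity passes the value 1 from the whole interval to each subinterval.
  exact ⟨s, hz.trans hX hs, hs.pieceVal hφ hz1⟩

/-- Every structure has a linear order all of whose one-point intervals are good. -/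
theorem Character.exists_good_flag (hX : X.IsLinearized) {φ : X.Character}
    (hφ : φ.IsBalancedConvex) (h : H.obj N) :
    ∃ r : N → ℕ, Set.BijOn r Set.univ (Set.Iio (Nat.card N)) ∧
      ∀ a < Nat.card N, φ.Good h {x | r x < a} {x | r x < a + 1} := by
  obtain ⟨r, hr, H1⟩ := HopfMonoid.exists_flag hX hφ (Nat.card N) (Piece.top h) (Set.ncard_univ N)
  refine ⟨r, hr, fun a ha => ?_⟩
  obtain ⟨z, hz⟩ := H1 a (a + 1) (Nat.le_succ a) ha
  simp only [Piece.top, Set.mem_univ, true_and] at hz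
  -- Here φ(h) itself may be 0: the intervals are single points, so the singleton axiom suffices.
  refine ⟨z, hz, hφ.singleton _ _ ?_⟩
  have : z.1 = {x | r x = a} := by
    rw [hz.eq_diff]
    ext x
    simp
    omega
  obtain ⟨p, -, hp⟩ := hr.surjOn ha
  rw [Nat.card_coe_set_eq, Set.ncard_eq_one]
  refine ⟨p, this.trans ?_⟩
  ext x
  simp only [Set.mem_ofPred_eq, Set.mem_singleton_iff]
  rw [← hp]
  exact ⟨fun hx => hr.injOn trivial trivial hx, fun hx => hx ▸ rfl⟩

end HopfMonoid

/-! ### Blocks of compositions -/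

namespace Composition

variable {n : ℕ}

/-- Sublevel sets of `α.index` are initial segments of `Fin n`; this translates properness of
`α.index ∘ e` into goodness of intervals of the order `e`. -/
theorem index_lt_iff (α : Composition n) (x : Fin n) (j : Fin α.length) :
    α.index x < j ↔ (x : ℕ) < α.sizeUpTo j := by
  constructor
  · intro h
    exact (α.lt_sizeUpTo_index_succ x).trans_le (α.monotone_sizeUpTo (Nat.succ_le_of_lt h))
  · intro h
    by_contra! hj
    exact absurd h (not_lt.2 ((α.monotone_sizeUpTo hj).trans (α.sizeUpTo_index_le x)))

theorem index_le_iff (α : Composition n) (x : Fin n) (j : Fin α.length) :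
    α.index x ≤ j ↔ (x : ℕ) < α.sizeUpTo (j + 1) := by
  constructor
  · intro h
    exact (α.lt_sizeUpTo_index_succ x).trans_le (α.monotone_sizeUpTo (Nat.succ_le_succ h))
  · intro h
    by_contra! hj
    exact absurd h
      (not_lt.2 ((α.monotone_sizeUpTo (Nat.succ_le_of_lt hj)).trans (α.sizeUpTo_index_le x)))

theorem card_index_eq (α : Composition n) (j : Fin α.length) :
    Nat.card {x // α.index x = j} = α.blocksFun j := by
  rw [← Nat.card_fin (α.blocksFun j)]
  refine (Nat.card_congr (Equiv.ofBijective
    (fun k => (⟨α.embedding j k, α.index_embedding j k⟩ : {x // α.index x = j})) ⟨?_, ?_⟩)).symm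
  · intro k k' hk
    exact (α.embedding j).injective (congrArg Subtype.val hk)
  · rintro ⟨x, rfl⟩
    exact ⟨α.invEmbedding x, Subtype.ext (α.embedding_comp_inv x)⟩

theorem mem_boundaries_iff (α : Composition n) (b : Fin (n + 1)) :
    b ∈ α.boundaries ↔ ∃ i ≤ α.length, α.sizeUpTo i = b := by
  simp only [boundaries, Finset.mem_map, Finset.mem_univ, true_and]
  constructor
  · rintro ⟨i, rfl⟩
    exact ⟨i, Nat.lt_succ_iff.1 i.2, rfl⟩
  · rintro ⟨i, hi, h⟩
    exact ⟨⟨i, Nat.lt_succ_iff.2 hi⟩, Fin.ext h⟩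

end Composition

/-! ### Refinement of compositions -/

section Refines

variable {n : ℕ} {α β : Composition n}

theorem Refines.exists_sizeUpTo (h : Refines α β) {i : ℕ} (hi : i ≤ α.length) :
    ∃ k ≤ β.length, β.sizeUpTo k = α.sizeUpTo i :=
  (β.mem_boundaries_iff ⟨α.sizeUpTo i, Nat.lt_succ_iff.2 (α.sizeUpTo_le i)⟩).1
    (h ((α.mem_boundaries_iff _).2 ⟨i, hi, rfl⟩))

/-- With `Refines.sizeUpTo_succ_le`, this says that the β-block of `x` lies in its α-block: the ends
of the α-block are partial sums of β, and none of these falls strictly inside a β-block. -/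
theorem Refines.sizeUpTo_index_le (h : Refines α β) (x : Fin n) :
    α.sizeUpTo (α.index x) ≤ β.sizeUpTo (β.index x) := by
  obtain ⟨k, hk, hk'⟩ := h.exists_sizeUpTo (α.index x).2.le
  rw [← hk']
  refine β.monotone_sizeUpTo ?_
  by_contra! hlt
  have h1 := β.lt_sizeUpTo_index_succ x
  have h2 := β.monotone_sizeUpTo (Nat.succ_le_of_lt hlt)
  have h3 := α.sizeUpTo_index_le x
  simp only [Fin.val_succ, Nat.succ_eq_add_one] at h1 h2
  omega

theorem Refines.sizeUpTo_succ_le (h : Refines α β) (x : Fin n) :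
    β.sizeUpTo (β.index x + 1) ≤ α.sizeUpTo (α.index x + 1) := by
  obtain ⟨k, hk, hk'⟩ := h.exists_sizeUpTo (i := α.index x + 1) (α.index x).2
  rw [← hk']
  refine β.monotone_sizeUpTo ?_
  by_contra! hlt
  have h1 := α.lt_sizeUpTo_index_succ x
  have h2 := β.monotone_sizeUpTo (Nat.lt_succ_iff.1 hlt)
  have h3 := β.sizeUpTo_index_le x
  simp only [Fin.val_succ] at h1
  omega

/-- The map `c` sends a β-block to the α-block containing it; it is the merging of colors behind c_α
≤ c_β. -/
theorem Refines.exists_index_comp (h : Refines α β) :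
    ∃ c : Fin β.length → Fin α.length, ∀ x, c (β.index x) = α.index x := by
  have hex : ∀ x y, β.index x = β.index y → α.index x = α.index y := by
    have hle : ∀ x y, β.index x = β.index y → α.index x ≤ α.index y := by
      intro x y hxy
      rw [α.index_le_iff]
      have h1 := β.lt_sizeUpTo_index_succ x
      rw [hxy] at h1
      exact h1.trans_le (h.sizeUpTo_succ_le y)
    exact fun x y hxy => le_antisymm (hle x y hxy) (hle y x hxy.symm)
  have hs : ∀ j, ∃ x, β.index x = j := fun j =>
    ⟨β.embedding j ⟨0, β.one_le_blocksFun j⟩, β.index_embedding _ _⟩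
  choose s hs using hs
  exact ⟨fun j => α.index (s j), fun x => hex _ _ (hs _)⟩

end Refines

namespace HopfMonoid.Character

variable {K : Type*} [Field K] {H : SetSpecies.{u, v}} {X : HopfMonoid (H.linearization K)}
variable {N : Type u} [Finite N] {n : ℕ}

/-! ### Proper colorings of a given type -/

/-- The proper colorings with colors `0, …, k - 1` whose color classes have the sizes
`α_1, …, α_k`. -/
def TypeColorings (φ : X.Character) (h : H.obj N) (α : Composition n) :
    Set (N → Fin α.length) :=
  {f | (∀ j, Nat.card {v // f v = j} = α.blocksFun j) ∧ φ.ProperMap h f}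

theorem typeColorings_perm {φ : X.Character} {h : H.obj N} {α : Composition n}
    {f : N → Fin α.length} (hf : f ∈ φ.TypeColorings h α) {g : Equiv.Perm N} (hg : g ∈ H.aut h) :
    f ∘ ⇑g⁻¹ ∈ φ.TypeColorings h α := by
  refine ⟨fun j => ?_, hf.2.perm hg⟩
  rw [← hf.1 j]
  exact Nat.card_congr ((g⁻¹).subtypeEquiv fun _ => Iff.rfl)

theorem typeColorings_surjective {φ : X.Character} {h : H.obj N} {α : Composition n}
    {f : N → Fin α.length} (hf : f ∈ φ.TypeColorings h α) : Function.Surjective f := by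
  intro j
  have : 0 < Nat.card {v // f v = j} := by
    rw [hf.1]
    exact α.one_le_blocksFun j
  obtain ⟨v, hv⟩ := (Nat.card_pos_iff.1 this).1
  exact ⟨v, hv⟩

omit [Finite N] in
theorem card_index_comp_eq (α : Composition n) (e : N ≃ Fin n) (j : Fin α.length) :
    Nat.card {v // (α.index ∘ e) v = j} = α.blocksFun j := by
  rw [← α.card_index_eq j]
  exact Nat.card_congr (e.subtypeEquiv fun _ => Iff.rfl)

/-- A proper coloring comes from a linear order on `N` which refines it properly. -/
theorem exists_order_of_mem_typeColorings (hX : X.IsLinearized) {φ : X.Character}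
    (hφ : φ.IsBalancedConvex) {h : H.obj N} {α : Composition n} {f : N → Fin α.length}
    (hf : f ∈ φ.TypeColorings h α) :
    ∃ e : N ≃ Fin n, α.index ∘ e = f ∧
      ∀ β, Refines α β → β.index ∘ e ∈ φ.TypeColorings h β := by
  have hdiff : ∀ j, {w | f w ≤ j} \ {w | f w < j} = {w | f w = j} := by
    intro j
    ext w
    simp only [Set.mem_sdiff, Set.mem_ofPred_eq, not_lt]
    exact ⟨fun hw => le_antisymm hw.1 hw.2, fun hw => ⟨hw.le, hw.ge⟩⟩
  have hcard : ∀ j, {w | f w = j}.ncard = α.blocksFun j := hf.1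
  have hflag : ∀ j, ∃ r : N → ℕ, Set.BijOn r {w | f w = j} (Set.Iio (α.blocksFun j)) ∧
      ∀ a b, a ≤ b → b ≤ α.blocksFun j →
        φ.Good h ({w | f w < j} ∪ {w ∈ {w | f w = j} | r w < a})
          ({w | f w < j} ∪ {w ∈ {w | f w = j} | r w < b}) := by
    intro j
    obtain ⟨v, rfl⟩ := typeColorings_surjective hf j
    have := (hf.2 v).exists_flag hX hφ
    rwa [hdiff, hcard] at this
  choose r hr hgood using hflag
  have hlt : ∀ v, r (f v) v < α.blocksFun (f v) := fun v => (hr (f v)).mapsTo rfl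
  -- The flags of the color classes are concatenated: class `j` fills the `j`-th block of α in the
  -- order given by `r j`.
  let E : N → Fin n := fun v => α.embedding (f v) ⟨r (f v) v, hlt v⟩
  have hEindex : ∀ v, α.index (E v) = f v := fun v => α.index_embedding _ _
  have hE : ∀ v, (E v : ℕ) = α.sizeUpTo (f v) + r (f v) v := fun v => α.coe_embedding _ _
  have hinj : Function.Injective E := by
    intro v w hvw
    have h1 : f v = f w := by rw [← hEindex v, hvw, hEindex]
    have h2 := (hE v).symm.trans ((congrArg Fin.val hvw).trans (hE w))
    rw [h1] at h2
    exact (hr (f w)).injOn h1 rfl (Nat.add_left_cancel h2)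
  have hsurj : Function.Surjective E := by
    intro x
    obtain ⟨v, hv, hv'⟩ := (hr (α.index x)).surjOn (α.invEmbedding x).2
    refine ⟨v, Fin.ext ?_⟩
    have hv : f v = α.index x := hv
    rw [hE, hv, hv', α.coe_invEmbedding]
    have := α.sizeUpTo_index_le x
    omega
  refine ⟨Equiv.ofBijective E ⟨hinj, hsurj⟩, funext hEindex, fun β hβ => ⟨?_, ?_⟩⟩
  · exact card_index_comp_eq β _
  intro v
  simp only [Function.comp_apply, β.index_lt_iff, β.index_le_iff]
  change φ.Good h {w | (E w : ℕ) < β.sizeUpTo (β.index (E v))}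
    {w | (E w : ℕ) < β.sizeUpTo (β.index (E v) + 1)}
  -- A β-block lies in a single α-block, so both of its ends satisfy these bounds. The sublevel set
  -- is then the union of the lower color classes and a prefix of one flag, as in `hgood`.
  have key : ∀ a, α.sizeUpTo (f v) ≤ a → a ≤ α.sizeUpTo (f v + 1) →
      {w | (E w : ℕ) < a} =
        {w | f w < f v} ∪ {w ∈ {w | f w = f v} | r (f v) w < a - α.sizeUpTo (f v)} := by
    intro a ha ha'
    ext w
    simp only [Set.mem_union, Set.mem_ofPred_eq]
    rcases lt_trichotomy (f w) (f v) with hw | hw | hw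
    · simp only [hw, true_or, iff_true]
      have := (α.index_lt_iff (E w) (f v)).1 (by rwa [hEindex])
      omega
    · have := hE w
      rw [hw] at this
      simp only [hw, lt_irrefl, false_or, true_and]
      omega
    · have h1 : ¬ (E w : ℕ) < α.sizeUpTo (f v + 1) := by
        rw [← α.index_le_iff, hEindex]
        exact not_le.2 hw
      simp only [hw.not_gt, hw.ne', false_and, or_false, iff_false]
      omega
  have hlo := hβ.sizeUpTo_index_le (E v)
  have hhi := hβ.sizeUpTo_succ_le (E v)
  have hmono := β.monotone_sizeUpTo (Nat.le_succ (β.index (E v)))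
  rw [hEindex] at hlo hhi
  rw [key _ hlo (hmono.trans hhi), key _ (hlo.trans hmono) hhi]
  refine hgood (f v) _ _ (Nat.sub_le_sub_right hmono _) ?_
  have := α.sizeUpTo_succ' (f v)
  simp only [Nat.succ_eq_add_one] at *
  omega

theorem exists_mem_typeColorings_ones (hX : X.IsLinearized) {φ : X.Character}
    (hφ : φ.IsBalancedConvex) (h : H.obj N) (hn : Nat.card N = n) :
    (φ.TypeColorings h (Composition.ones n)).Nonempty := by
  obtain ⟨r, hr, hgood⟩ := exists_good_flag hX hφ h
  rw [hn] at hr hgood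
  have hlt : ∀ v, r v < n := fun v => hr.mapsTo (Set.mem_univ v)
  let e : N ≃ Fin n := Equiv.ofBijective (fun v => ⟨r v, hlt v⟩)
    ⟨fun v w hvw => hr.injOn trivial trivial (congrArg Fin.val hvw), fun x => by
      obtain ⟨v, -, hv⟩ := hr.surjOn x.2
      exact ⟨v, Fin.ext hv⟩⟩
  refine ⟨(Composition.ones n).index ∘ e, card_index_comp_eq _ e, fun v => ?_⟩
  simp only [Function.comp_apply, Composition.index_lt_iff, Composition.index_le_iff]
  have h1 := (Composition.ones n).sizeUpTo_index_le (e v)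
  have h2 := (Composition.ones n).lt_sizeUpTo_index_succ (e v)
  simp only [Composition.ones_sizeUpTo, Fin.val_succ] at h1 h2 ⊢
  have h3 : (e v : ℕ) < n := (e v).2
  -- `ones_sizeUpTo` truncates the partial sums at `n`; `h1` and `h2` squeeze the index of `e v` to
  -- `r v`.
  have h4 : min ((Composition.ones n).index (e v) : ℕ) n = r v := by
    change _ = (e v : ℕ)
    omega
  have h5 : min ((Composition.ones n).index (e v) + 1 : ℕ) n = r v + 1 := by
    change _ = (e v : ℕ) + 1
    omega
  rw [h4, h5]
  exact hgood _ (hlt v)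

end HopfMonoid.Character

/-! ### Permutation characters of sets of colorings -/

section Colorings

variable {N : Type u} {T T' : Type*} (G : Subgroup (Equiv.Perm N))

/-- The action of a group of permutations of `N` on a stable set of colorings of `N`. -/
abbrev coloringAction (F : Set (N → T)) (hF : ∀ g ∈ G, ∀ f ∈ F, f ∘ ⇑g⁻¹ ∈ F) :
    MulAction G ↥F where
  smul g f := ⟨f.1 ∘ ⇑(g : Equiv.Perm N)⁻¹, hF g g.2 f.1 f.2⟩
  one_smul f := Subtype.ext (by ext; rfl)
  mul_smul a b f := Subtype.ext (by
    ext v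
    change f.1 ((a.1 * b.1)⁻¹ v) = f.1 (b.1⁻¹ (a.1⁻¹ v))
    rw [mul_inv_rev, Equiv.Perm.mul_apply])

/-- The number of colorings in `F` fixed by `g`. -/
def fixedCount (F : Set (N → T)) (g : Equiv.Perm N) : ℕ :=
  Nat.card {f // f ∈ F ∧ f ∘ ⇑g⁻¹ = f}

variable {G}

theorem permRep_coloringAction_character {F : Set (N → T)} [Finite ↥F]
    (hF : ∀ g ∈ G, ∀ f ∈ F, f ∘ ⇑g⁻¹ ∈ F) :
    letI := coloringAction G F hF
    (permRep G ↥F).character = fun g : G => (fixedCount F (g : Equiv.Perm N) : ℂ) := by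
  let := coloringAction G F hF
  funext g
  rw [permRep_character, fixedCount]
  congr 1
  refine Nat.card_congr ((Equiv.subtypeEquivRight fun y => ?_).trans
    (Equiv.subtypeSubtypeEquivSubtypeInter (· ∈ F) fun f => f ∘ ⇑(g : Equiv.Perm N)⁻¹ = f))
  exact Subtype.ext_iff

/-- Recoloring by `c` commutes with permuting `N`. It may leave `F'`, so it is used as a partial
map; stability of `F'` under inverses makes its domain invariant, and `hc` makes it onto. -/
theorem effLE_fixedCount {F : Set (N → T)} {F' : Set (N → T')} [Finite ↥F] [Finite ↥F']
    (hF : ∀ g ∈ G, ∀ f ∈ F, f ∘ ⇑g⁻¹ ∈ F) (hF' : ∀ g ∈ G, ∀ f ∈ F', f ∘ ⇑g⁻¹ ∈ F')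
    (c : T → T') (hc : ∀ f' ∈ F', ∃ f ∈ F, c ∘ f = f') :
    EffLE (fun g : G => (fixedCount F' (g : Equiv.Perm N) : ℂ))
      (fun g : G => (fixedCount F (g : Equiv.Perm N) : ℂ)) := by
  classical
  let := coloringAction G F hF
  let := coloringAction G F' hF'
  rw [← permRep_coloringAction_character hF, ← permRep_coloringAction_character hF']
  refine effLE_permRep (fun f => if h : c ∘ f.1 ∈ F' then some ⟨c ∘ f.1, h⟩ else none) ?_ ?_
  · intro g f
    have h1 : (g • f).1 = f.1 ∘ ⇑(g : Equiv.Perm N)⁻¹ := rfl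
    have h2 : c ∘ (g • f).1 ∈ F' ↔ c ∘ f.1 ∈ F' := by
      refine ⟨fun h => ?_, fun h => hF' g g.2 _ h⟩
      convert! hF' g⁻¹ (g⁻¹).2 _ h using 1
      rw [h1]
      ext v
      simp
    by_cases h : c ∘ f.1 ∈ F'
    · rw [dif_pos h, dif_pos (h2.2 h)]
      rfl
    · rw [dif_neg h, dif_neg fun h' => h (h2.1 h')]
      rfl
  · rintro ⟨f', hf'⟩
    obtain ⟨f, hf, rfl⟩ := hc f' hf'
    exact ⟨⟨f, hf⟩, dif_pos hf'⟩

/-- Burnside's lemma for colorings. -/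
theorem card_quotient_orbitSetoid [Finite N] {F : Set (N → ℕ+)} [Finite ↥F]
    (hF : ∀ g ∈ G, ∀ f ∈ F, f ∘ ⇑g⁻¹ ∈ F) :
    (Nat.card (Quotient (orbitSetoid G F)) : ℝ) =
      groupAverage G fun g => (fixedCount F (g : Equiv.Perm N) : ℂ) := by
  classical
  let := coloringAction G F hF
  have := Fintype.ofFinite G
  have := Fintype.ofFinite ↥F
  have h := MulAction.sum_card_fixedBy_eq_card_orbits_mul_card_group G ↥F
  have h1 : orbitSetoid G F = MulAction.orbitRel G ↥F := by
    ext f f'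
    rw [MulAction.orbitRel_apply]
    constructor
    · rintro ⟨g, hg, h⟩
      exact ⟨⟨g, hg⟩, Subtype.ext h.symm⟩
    · rintro ⟨g, hg⟩
      exact ⟨g.1, g.2, congrArg Subtype.val hg.symm⟩
  have h2 : ∀ g : G, fixedCount F (g : Equiv.Perm N) =
      Fintype.card (MulAction.fixedBy ↥F g) := by
    intro g
    rw [fixedCount, ← Nat.card_eq_fintype_card]
    refine (Nat.card_congr ((Equiv.subtypeEquivRight fun y => ?_).trans
      (Equiv.subtypeSubtypeEquivSubtypeInter (· ∈ F)
        fun f => f ∘ ⇑(g : Equiv.Perm N)⁻¹ = f))).symm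
    exact Subtype.ext_iff
  rw [groupAverage_apply, h1]
  simp only [h2, Complex.natCast_re]
  rw [← Nat.cast_sum, h, Nat.cast_mul, ← Nat.card_eq_fintype_card (α := G),
    ← Nat.card_eq_fintype_card, mul_comm, mul_assoc, mul_inv_cancel₀, mul_one]
  exact_mod_cast Nat.card_pos.ne'

end Colorings

/-! ### Decomposing colorings by their type -/

/-- The length is `k` only up to a proof, hence the cast. -/
theorem Composition.exists_of_card {n k : ℕ} (s : Fin k → ℕ) (hpos : ∀ j, 0 < s j)
    (hsum : ∑ j, s j = n) :
    ∃ (α : Composition n) (hα : α.length = k), ∀ j, α.blocksFun j = s (Fin.cast hα j) := by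
  refine ⟨⟨List.ofFn s, ?_, ?_⟩, by simp [Composition.length], fun j => ?_⟩
  · intro i hi
    obtain ⟨j, rfl⟩ := List.mem_ofFn.1 hi
    exact hpos j
  · rw [List.sum_ofFn, hsum]
  · simp [Composition.blocksFun]
    rfl

namespace HopfMonoid.Character

variable {K : Type*} [Field K] {H : SetSpecies.{u, v}} {X : HopfMonoid (H.linearization K)}
variable {N : Type u} [Finite N] {n : ℕ}

/-- Every proper coloring is a strictly increasing relabeling of a proper coloring of some type. -/
theorem exists_typeColorings {φ : X.Character} {h : H.obj N} (hn : Nat.card N = n) {f : N → ℕ+}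
    (hf : f ∈ φ.Colorings h) :
    ∃ (α : Composition n) (i : Fin α.length → ℕ+) (f' : N → Fin α.length),
      StrictMono i ∧ f' ∈ φ.TypeColorings h α ∧ i ∘ f' = f := by
  classical
  have := Fintype.ofFinite N
  let s : Finset ℕ+ := Finset.univ.image f
  let i : Fin s.card ↪o ℕ+ := s.orderEmbOfFin rfl
  have hex : ∀ v, ∃ j, i j = f v := by
    intro v
    have : f v ∈ Set.range i := by
      rw [Finset.range_orderEmbOfFin]
      simp [s]
    exact this
  choose f' hf' using hex
  have hf'' : i ∘ f' = f := funext hf'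
  have hpos : ∀ j, 0 < Nat.card {v // f' v = j} := by
    intro j
    have : i j ∈ s := Finset.orderEmbOfFin_mem s rfl j
    obtain ⟨v, -, hv⟩ := Finset.mem_image.1 this
    have : Nonempty {v // f' v = j} := ⟨v, i.injective (by rw [hf', hv])⟩
    exact Nat.card_pos
  have hsum : ∑ j, Nat.card {v // f' v = j} = n := by
    rw [← hn, ← Nat.card_sigma]
    exact Nat.card_congr (Equiv.sigmaFiberEquiv f')
  obtain ⟨α, hα, hb⟩ := Composition.exists_of_card _ hpos hsum
  have hproper : φ.ProperMap h f' := by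
    rw [← φ.properMap_comp_iff h i.strictMono, hf'', ← φ.isProper_iff]
    exact hf
  -- Forgetting how `i` and `s` were built lets `s.card` become a variable, so that `subst`
  -- identifies the two types of colors.
  clear_value i s
  clear hpos hsum
  generalize s.card = k at *
  subst hα
  exact ⟨α, i, f', i.strictMono, ⟨fun j => (hb j).symm, hproper⟩, hf''⟩

/-- Colorings of a given type are surjective, so the composite determines the range of `i`, and a
strictly increasing map on `Fin k` is determined by its range. Injectivity of `i` then recovers `f`,
and the class sizes recover α. -/
theorem typeColorings_unique {φ : X.Character} {h : H.obj N} {α β : Composition n}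
    {i : Fin α.length → ℕ+} {f : N → Fin α.length} {i' : Fin β.length → ℕ+}
    {f' : N → Fin β.length} (hi : StrictMono i) (hf : f ∈ φ.TypeColorings h α)
    (hi' : StrictMono i') (hf' : f' ∈ φ.TypeColorings h β) (heq : i ∘ f = i' ∘ f') :
    α = β ∧ i ≍ i' ∧ f ≍ f' := by
  have hrange : Set.range i = Set.range i' := by
    rw [← (typeColorings_surjective hf).range_comp, heq, (typeColorings_surjective hf').range_comp]
  have hlen : α.length = β.length := by
    have h1 := congrArg Nat.card (congrArg Set.Elem hrange)
    rwa [Nat.card_range_of_injective hi.injective, Nat.card_range_of_injective hi'.injective,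
      Nat.card_fin, Nat.card_fin] at h1
  have key : ∀ (k : ℕ) (hk : k = β.length) (i : Fin k → ℕ+) (f : N → Fin k), StrictMono i →
      Set.range i = Set.range i' → i ∘ f = i' ∘ f' →
      i ≍ i' ∧ f ≍ f' ∧ ∀ j : Fin k, Nat.card {v // f v = j} =
        Nat.card {v // f' v = Fin.cast hk j} := by
    rintro _ rfl i f hi hr he
    obtain rfl := (hi.range_inj hi').1 hr
    obtain rfl : f = f' := funext fun v => hi.injective (congrFun he v)
    exact ⟨HEq.rfl, HEq.rfl, fun j => rfl⟩
  obtain ⟨h1, h2, h3⟩ := key _ hlen i f hi hrange heq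
  refine ⟨Composition.ext ?_, h1, h2⟩
  refine List.ext_getElem hlen fun j hj hj' => ?_
  have := h3 ⟨j, hj⟩
  rw [hf.1, hf'.1] at this
  exact this

/-- Proper colorings fixed by `g` with a given property, counted by type. -/
theorem card_colorings_eq_sum (φ : X.Character) (h : H.obj N) (hn : Nat.card N = n)
    (g : Equiv.Perm N) (Q : (N → ℕ+) → Prop)
    (R : ∀ α : Composition n, (Fin α.length → ℕ+) → Prop)
    (hQR : ∀ α i, ∀ f ∈ φ.TypeColorings h α, Q (i ∘ f) ↔ R α i)
    [∀ α, Finite {i // StrictMono i ∧ R α i}] :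
    Nat.card {f : N → ℕ+ // f ∈ φ.Colorings h ∧ f ∘ ⇑g⁻¹ = f ∧ Q f} =
      ∑ α : Composition n,
        Nat.card {i // StrictMono i ∧ R α i} * fixedCount (φ.TypeColorings h α) g := by
  simp only [fixedCount, ← Nat.card_prod]
  rw [← Nat.card_sigma]
  refine (Nat.card_congr (Equiv.ofBijective (fun s => ⟨s.2.1.1 ∘ s.2.2.1,
    (φ.isProper_iff h _).2 ((φ.properMap_comp_iff h s.2.1.2.1 _).2 s.2.2.2.1.2),
    by rw [Function.comp_assoc, s.2.2.2.2], (hQR _ _ _ s.2.2.2.1).2 s.2.1.2.2⟩) ⟨?_, ?_⟩)).symm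
  · rintro ⟨α, ⟨i, hi, hiR⟩, ⟨f, hf, hfg⟩⟩ ⟨β, ⟨i', hi', hiR'⟩, ⟨f', hf', hfg'⟩⟩ heq
    obtain ⟨rfl, h1, h2⟩ := typeColorings_unique hi hf hi' hf' (congrArg Subtype.val heq)
    obtain rfl := eq_of_heq h1
    obtain rfl := eq_of_heq h2
    rfl
  · rintro ⟨f, hf, hfg, hfQ⟩
    obtain ⟨α, i, f', hi, hf', rfl⟩ := exists_typeColorings hn hf
    refine ⟨⟨α, ⟨i, hi, (hQR α i f' hf').1 hfQ⟩, ⟨f', hf', ?_⟩⟩, rfl⟩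
    funext v
    exact hi.injective (congrFun hfg v)

end HopfMonoid.Character

/-! ### Increasing families of characters on the Boolean lattice -/

section Boolean

open Finset

variable {m : ℕ}

/-- Matchings between the levels `k` and `l` of the Boolean lattice of rank `m`. -/
theorem exists_injective_subset {k l : ℕ} (hkl : k ≤ l) (hlm : l + k ≤ m) :
    ∃ f : powersetCard k (univ : Finset (Fin m)) → powersetCard l (univ : Finset (Fin m)),
      Function.Injective f ∧ ∀ s, s.1 ⊆ (f s).1 := by
  classical
  rw [← Fintype.all_card_le_filter_rel_iff_exists_injective fun
    (s : powersetCard k (univ : Finset (Fin m))) (t : powersetCard l (univ : Finset (Fin m))) =>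
      s.1 ⊆ t.1]
  intro A
  -- Hall's condition by double counting: a `k`-set has binom(m - k, l - k) supersets of size `l`,
  -- while an `l`-set has binom(l, l - k) subsets of size `k`, which is no more because l ≤ m - k.
  refine Nat.le_of_mul_le_mul_right (c := (m - k).choose (l - k)) ?_
    (Nat.choose_pos (by omega))
  refine card_mul_le_card_mul (fun s t => s.1 ⊆ t.1) ?_ ?_
  · intro s hs
    have hsk : #s.1 = k := (mem_powersetCard.1 s.2).2
    have h1 : #(powersetCard (l - k) s.1ᶜ) = (m - k).choose (l - k) := by
      rw [card_powersetCard, card_compl, hsk, Fintype.card_fin]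
    rw [← h1]
    have hdisj : ∀ u ∈ powersetCard (l - k) s.1ᶜ, Disjoint s.1 u := fun u hu =>
      disjoint_of_subset_right (mem_powersetCard.1 hu).1 disjoint_compl_right
    have hmem : ∀ u ∈ powersetCard (l - k) s.1ᶜ,
        s.1 ∪ u ∈ powersetCard l (univ : Finset (Fin m)) := by
      intro u hu
      rw [mem_powersetCard_univ, card_union_of_disjoint (hdisj u hu), hsk,
        (mem_powersetCard.1 hu).2]
      omega
    -- The second branch is an arbitrary `l`-set that only makes the function total.
    refine card_le_card_of_injOn (fun u => if h : u ∈ powersetCard (l - k) s.1ᶜ then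
      ⟨s.1 ∪ u, hmem u h⟩ else ⟨_, (powersetCard_nonempty.2 (by simp; omega)).choose_spec⟩) ?_ ?_
    · intro u hu
      have hu : u ∈ powersetCard (l - k) s.1ᶜ := hu
      simp only [dif_pos hu, coe_bipartiteAbove, mem_filter, mem_univ, true_and,
        Set.mem_ofPred_eq]
      exact ⟨⟨s, hs, subset_union_left⟩, subset_union_left⟩
    · intro u hu u' hu' h
      have hu : u ∈ powersetCard (l - k) s.1ᶜ := hu
      have hu' : u' ∈ powersetCard (l - k) s.1ᶜ := hu'
      simp only [dif_pos hu, dif_pos hu', Subtype.mk.injEq] at h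
      rw [← union_sdiff_cancel_left (hdisj u hu), h, union_sdiff_cancel_left (hdisj u' hu')]
  · intro t ht
    have htl : #t.1 = l := (mem_powersetCard.1 t.2).2
    calc #(bipartiteBelow (fun s t => s.1 ⊆ t.1) A t)
        ≤ #(powersetCard k t.1) := by
          refine card_le_card_of_injOn Subtype.val ?_ Subtype.val_injective.injOn
          intro s hs
          have hs := (mem_bipartiteBelow _).1 hs
          exact mem_powersetCard.2 ⟨hs.2, (mem_powersetCard.1 s.2).2⟩
      _ = l.choose k := by rw [card_powersetCard, htl]
      _ = l.choose (l - k) := (Nat.choose_symm hkl).symm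
      _ ≤ (m - k).choose (l - k) := Nat.choose_le_choose _ (by omega)

variable {G : Type*} [Group G] {c : Finset (Fin m) → G → ℂ}

/-- Each `c s` is bounded by its partner under a matching of the levels, and the unmatched terms of
the upper level are effective. -/
theorem effLE_level (hc : ∀ s t, s ⊆ t → EffLE (c s) (c t)) {k l : ℕ} (hkl : k ≤ l)
    (hlm : l + k ≤ m) :
    EffLE (∑ s ∈ powersetCard k univ, c s) (∑ s ∈ powersetCard l univ, c s) := by
  classical
  obtain ⟨f, hf, hsub⟩ := exists_injective_subset hkl hlm
  rw [← sum_coe_sort, ← sum_coe_sort (powersetCard l univ),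
    ← sum_add_sum_compl (univ.map ⟨f, hf⟩), sum_map, ← add_zero (∑ s : powersetCard k (univ : Finset (Fin m)), c s.1)]
  refine (EffLE.sum _ fun s _ => hc _ _ (hsub s)).add (IsEffective.effLE_zero ?_)
  exact .sum _ fun t _ => (hc _ _ subset_rfl).left

/-- Both sides are sums over pairs `(s, x)` with `x ∉ s`, of `c s` and of `c (insert x s)`: a
`k`-set has `m - k` such `x`, and a `(k + 1)`-set arises from `k + 1` pairs. -/
theorem effLE_level_succ (hc : ∀ s t, s ⊆ t → EffLE (c s) (c t)) (k : ℕ) :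
    EffLE ((m - k) • ∑ s ∈ powersetCard k univ, c s)
      ((k + 1) • ∑ s ∈ powersetCard (k + 1) univ, c s) := by
  have h1 : (m - k) • ∑ s ∈ powersetCard k (univ : Finset (Fin m)), c s =
      ∑ p ∈ (powersetCard k univ).sigma fun s => sᶜ, c p.1 := by
    rw [sum_sigma, smul_sum]
    refine sum_congr rfl fun s hs => ?_
    dsimp only
    rw [sum_const, card_compl, Fintype.card_fin, (mem_powersetCard.1 hs).2]
  have h2 : (k + 1) • ∑ s ∈ powersetCard (k + 1) (univ : Finset (Fin m)), c s =
      ∑ p ∈ (powersetCard k univ).sigma fun s => sᶜ, c (insert p.2 p.1) := by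
    have : (k + 1) • ∑ s ∈ powersetCard (k + 1) (univ : Finset (Fin m)), c s =
        ∑ p ∈ (powersetCard (k + 1) univ).sigma fun s => s, c p.1 := by
      rw [sum_sigma, smul_sum]
      refine sum_congr rfl fun s hs => ?_
      dsimp only
      rw [sum_const, (mem_powersetCard.1 hs).2]
    rw [this]
    refine sum_bij' (fun p _ => ⟨p.1.erase p.2, p.2⟩) (fun p _ => ⟨insert p.2 p.1, p.2⟩)
      ?_ ?_ ?_ ?_ ?_
    · rintro ⟨t, x⟩ h
      simp only [mem_sigma, mem_powersetCard_univ] at h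
      simp [card_erase_of_mem h.2, h.1]
    · rintro ⟨t, x⟩ h
      simp only [mem_sigma, mem_powersetCard_univ, mem_compl] at h
      simp [card_insert_of_notMem h.2, h.1]
    · rintro ⟨t, x⟩ h
      simp only [mem_sigma, mem_powersetCard_univ] at h
      simp [insert_erase h.2]
    · rintro ⟨t, x⟩ h
      simp only [mem_sigma, mem_powersetCard_univ, mem_compl] at h
      simp [erase_insert h.2]
    · rintro ⟨t, x⟩ h
      simp only [mem_sigma, mem_powersetCard_univ] at h
      simp [insert_erase h.2]
  rw [h1, h2]
  exact EffLE.sum _ fun p _ => hc _ _ (subset_insert _ _)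

end Boolean

/-! ### Compositions as subsets -/

/-- The bijection between subsets of `{0, …, m - 1}` and compositions of `m + 1`. -/
def finsetEquivComposition (m : ℕ) : Finset (Fin m) ≃ Composition (m + 1) :=
  ((compositionEquiv (m + 1)).trans (compositionAsSetEquiv (m + 1))).symm

theorem boundaries_finsetEquivComposition {m : ℕ} (s : Finset (Fin m)) :
    (finsetEquivComposition m s).boundaries =
      insert 0 (insert (Fin.last _) (s.map (Fin.castSuccEmb.trans (Fin.succEmb _)))) := by
  change (((compositionAsSetEquiv (m + 1)).symm s).toComposition).boundaries = _
  rw [CompositionAsSet.toComposition_boundaries]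
  ext i
  simp only [compositionAsSetEquiv, Equiv.coe_fn_symm_mk, Set.mem_toFinset, Set.mem_ofPred_eq,
    Finset.mem_insert, Finset.mem_map, exists_prop]
  refine or_congr Iff.rfl (or_congr Iff.rfl (exists_congr fun j => and_congr Iff.rfl ?_))
  rw [Fin.ext_iff, eq_comm]
  rfl

theorem refines_finsetEquivComposition {m : ℕ} {s t : Finset (Fin m)} (h : s ⊆ t) :
    Refines (finsetEquivComposition m s) (finsetEquivComposition m t) := by
  rw [Refines, boundaries_finsetEquivComposition, boundaries_finsetEquivComposition]
  exact Finset.insert_subset_insert _ (Finset.insert_subset_insert _ (Finset.map_subset_map.2 h))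

theorem length_finsetEquivComposition {m : ℕ} (s : Finset (Fin m)) :
    (finsetEquivComposition m s).length = s.card + 1 := by
  have h := (finsetEquivComposition m s).card_boundaries_eq_succ_length
  rw [boundaries_finsetEquivComposition, Finset.card_insert_of_notMem,
    Finset.card_insert_of_notMem, Finset.card_map] at h
  · omega
  · simp only [Finset.mem_map, not_exists, not_and]
    intro j _ hj
    have := congrArg Fin.val hj
    simp at this
    omega
  · simp [Fin.ext_iff]

/-! ### Sums over compositions of a given length -/

section FVector

variable {n : ℕ} {A : Type*} [AddCommMonoid A]

/-- The sum of a function on compositions of `n` over the compositions of length `i`. -/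
def lengthSum (c : Composition n → A) (i : ℕ) : A :=
  ∑ α with α.length = i, c α

theorem lengthSum_succ {m : ℕ} (c : Composition (m + 1) → A) (k : ℕ) :
    lengthSum c (k + 1) =
      ∑ s ∈ Finset.powersetCard k Finset.univ, c (finsetEquivComposition m s) := by
  rw [lengthSum, Finset.sum_filter, ← (finsetEquivComposition m).sum_comp,
    ← Finset.sum_filter]
  refine Finset.sum_congr ?_ fun _ _ => rfl
  ext s
  simp [length_finsetEquivComposition]

theorem lengthSum_eq_zero (c : Composition n → A) {i : ℕ} (hi : n < i) : lengthSum c i = 0 := by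
  refine Finset.sum_eq_zero fun α hα => ?_
  have := α.length_le
  rw [(Finset.mem_filter.1 hα).2] at this
  omega

theorem lengthSum_zero {m : ℕ} (c : Composition (m + 1) → A) : lengthSum c 0 = 0 := by
  refine Finset.sum_eq_zero fun α hα => ?_
  have := α.length_eq_zero.1 (Finset.mem_filter.1 hα).2
  omega

theorem sum_lengthSum_mul {R : Type*} [CommSemiring R] (c : Composition n → R) (w : ℕ → R) :
    ∑ i ∈ Finset.range (n + 1), lengthSum c i * w i = ∑ α, c α * w α.length := by
  simp only [lengthSum, Finset.sum_mul]
  rw [← Finset.sum_fiberwise_of_maps_to (s := Finset.univ) (t := Finset.range (n + 1))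
    (g := Composition.length) fun α _ => Finset.mem_range.2 (Nat.lt_succ_of_le α.length_le)]
  refine Finset.sum_congr rfl fun i _ => Finset.sum_congr rfl fun α hα => ?_
  rw [(Finset.mem_filter.1 hα).2]


end FVector

variable {n : ℕ} {G : Type*} [Group G] {c : Composition n → G → ℂ}

theorem isEffective_lengthSum (hc : ∀ α β, Refines α β → EffLE (c α) (c β)) (i : ℕ) :
    IsEffective (lengthSum c i) :=
  .sum _ fun α _ => (hc α α (Finset.Subset.refl _)).left

/-- The `f`-vector of an increasing family is effectively flawless. -/
theorem isEffectivelyFlawless_lengthSum (hc : ∀ α β, Refines α β → EffLE (c α) (c β)) :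
    IsEffectivelyFlawless n (lengthSum c) := by
  -- Length `i` corresponds to level `i - 1` in the Boolean lattice of rank `n - 1`, so the matching
  -- condition on levels reads i + j ≤ n + 1.
  have key : ∀ i j, i ≤ j → i + j ≤ n + 1 → j ≤ n → EffLE (lengthSum c i) (lengthSum c j) := by
    intro i j hij hj hjn
    obtain _ | m := n
    · obtain rfl : i = j := by omega
      exact .refl (isEffective_lengthSum hc _)
    obtain _ | i := i
    · rw [lengthSum_zero]
      exact (isEffective_lengthSum hc _).effLE_zero
    obtain ⟨j, rfl⟩ : ∃ k, j = k + 1 := ⟨j - 1, by omega⟩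
    rw [lengthSum_succ, lengthSum_succ]
    exact effLE_level (fun s t h => hc _ _ (refines_finsetEquivComposition h)) (by omega)
      (by omega)
  exact ⟨fun i hi => key _ _ (by omega) (by omega) (by omega),
    fun i hi => key _ _ (by omega) (by omega) (by omega)⟩

theorem effLE_lengthSum_succ (hc : ∀ α β, Refines α β → EffLE (c α) (c β)) (i : ℕ) :
    EffLE (((n : ℂ) - (i : ℂ)) • lengthSum c i) ((i : ℂ) • lengthSum c (i + 1)) := by
  -- For i > n the scalar `n - i` is negative, but both entries vanish.
  obtain hi | hi := lt_or_ge n i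
  · rw [lengthSum_eq_zero c hi, lengthSum_eq_zero c (hi.trans (Nat.lt_succ_self i)), smul_zero,
      smul_zero]
    exact .refl .zero
  rw [← Nat.cast_sub hi, Nat.cast_smul_eq_nsmul, Nat.cast_smul_eq_nsmul]
  obtain _ | m := n
  · obtain rfl : i = 0 := by omega
    rw [Nat.sub_zero, zero_smul, zero_smul]
    exact .refl .zero
  obtain _ | k := i
  · rw [lengthSum_zero, smul_zero, zero_smul]
    exact .refl .zero
  rw [lengthSum_succ, lengthSum_succ, Nat.add_sub_add_right]
  exact effLE_level_succ (fun s t h => hc _ _ (refines_finsetEquivComposition h)) k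

/-! ### Polynomials in the binomial basis -/

section BinomPoly

variable {R : Type*} [Field R] [CharZero R]

theorem binomPoly_eval (i k : ℕ) : (binomPoly R i).eval (k : R) = k.choose i := by
  rw [binomPoly, Polynomial.eval_C_mul, descPochhammer_eval_eq_descFactorial,
    Nat.descFactorial_eq_factorial_mul_choose, Nat.cast_mul,
    inv_mul_cancel_left₀ (Nat.cast_ne_zero.2 i.factorial_ne_zero)]

theorem natDegree_C_mul_binomPoly {a : R} (ha : a ≠ 0) (i : ℕ) :
    (Polynomial.C a * binomPoly R i).natDegree = i := by
  rw [binomPoly, Polynomial.natDegree_C_mul ha,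
    Polynomial.natDegree_C_mul (inv_ne_zero (Nat.cast_ne_zero.2 i.factorial_ne_zero)),
    descPochhammer_natDegree]

theorem natDegree_C_mul_binomPoly_le (a : R) (i : ℕ) :
    (Polynomial.C a * binomPoly R i).natDegree ≤ i := by
  obtain rfl | ha := eq_or_ne a 0
  · simp
  · exact (natDegree_C_mul_binomPoly ha i).le

theorem natDegree_sum_binomPoly {f : ℕ → R} {d : ℕ} (hd : f d ≠ 0) :
    (∑ i ∈ Finset.range (d + 1), Polynomial.C (f i) * binomPoly R i).natDegree = d := by
  obtain _ | d := d
  · rw [Finset.sum_range_one]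
    exact natDegree_C_mul_binomPoly hd 0
  rw [Finset.sum_range_succ, Polynomial.natDegree_add_eq_right_of_natDegree_lt,
    natDegree_C_mul_binomPoly hd]
  rw [natDegree_C_mul_binomPoly hd, Nat.lt_succ_iff]
  refine Polynomial.natDegree_sum_le_of_forall_le _ _ fun i hi => ?_
  exact (natDegree_C_mul_binomPoly_le _ _).trans (Nat.lt_succ_iff.1 (Finset.mem_range.1 hi))

theorem eval_sum_binomPoly (f : ℕ → R) (d k : ℕ) :
    (∑ i ∈ Finset.range (d + 1), Polynomial.C (f i) * binomPoly R i).eval (k : R) =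
      ∑ i ∈ Finset.range (d + 1), f i * k.choose i := by
  simp [Polynomial.eval_finsetSum, binomPoly_eval]

end BinomPoly

section Average

variable {G : Type*} [Group G] [Finite G]

theorem groupAverage_ofReal_smul (r : ℝ) (χ : G → ℂ) :
    groupAverage G ((r : ℂ) • χ) = r * groupAverage G χ := by
  rw [← smul_eq_mul, ← map_smul]
  rfl

theorem groupAverage_natCast_pos {a : G → ℕ} (ha : a 1 ≠ 0) :
    0 < groupAverage G fun g => (a g : ℂ) := by
  have := Fintype.ofFinite G
  rw [groupAverage_apply]
  refine mul_pos (inv_pos.2 (by exact_mod_cast Nat.card_pos)) ?_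
  simp only [Complex.natCast_re]
  exact Finset.sum_pos' (fun g _ => Nat.cast_nonneg _)
    ⟨1, Finset.mem_univ _, by exact_mod_cast Nat.pos_of_ne_zero ha⟩

end Average

/-! ### Coefficients of the generating functions -/

theorem coeff_genFun {S : Type*} (w : S → (ℕ+ →₀ ℕ)) (m : ℕ+ →₀ ℕ) :
    MvPowerSeries.coeff m (genFun w) = (Nat.card {s : S // w s = m} : ℂ) := rfl

theorem finite_forall_mem {I : Type*} [Finite I] {s : Set ℕ+} (hs : s.Finite)
    {F : Set (I → ℕ+)} (hF : ∀ f ∈ F, ∀ v, f v ∈ s) : Finite ↥F :=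
  ((Set.Finite.pi' fun _ => hs).subset hF).to_subtype

theorem finite_le_natCast (k : ℕ) : {x : ℕ+ | (x : ℕ) ≤ k}.Finite :=
  (Set.finite_Iic k).preimage PNat.coe_injective.injOn

theorem mem_support_of_sum_single {I : Type*} [Fintype I] {i : I → ℕ+} {a : I → ℕ}
    {m : ℕ+ →₀ ℕ} (h : ∑ j, Finsupp.single (i j) (a j) = m) {j : I} (hj : a j ≠ 0) :
    i j ∈ m.support := by
  rw [Finsupp.mem_support_iff, ← h, Finsupp.finsetSum_apply]
  refine fun h0 => hj ?_
  have := Finset.sum_eq_zero_iff.1 h0 j (Finset.mem_univ j)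
  rwa [Finsupp.single_eq_same] at this

instance finite_strictMono_weight {n : ℕ} (α : Composition n) (m : ℕ+ →₀ ℕ) :
    Finite {i : Fin α.length → ℕ+ //
      StrictMono i ∧ ∑ j, Finsupp.single (i j) (α.blocksFun j) = m} :=
  finite_forall_mem (F := {i | StrictMono i ∧ ∑ j, Finsupp.single (i j) (α.blocksFun j) = m})
    m.support.finite_toSet fun _ hi j =>
      mem_support_of_sum_single hi.2 (Nat.one_le_iff_ne_zero.1 (α.one_le_blocksFun j))

instance finite_strictMono_le (l k : ℕ) :
    Finite {i : Fin l → ℕ+ // StrictMono i ∧ ∀ j, (i j : ℕ) ≤ k} :=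
  finite_forall_mem (F := {i | StrictMono i ∧ ∀ j, (i j : ℕ) ≤ k})
    (finite_le_natCast k) fun _ hi j => hi.2 j

theorem card_strictMono_le (l k : ℕ) :
    Nat.card {i : Fin l → ℕ+ // StrictMono i ∧ ∀ j, (i j : ℕ) ≤ k} = k.choose l := by
  have e : {i : Fin l → ℕ+ // StrictMono i ∧ ∀ j, (i j : ℕ) ≤ k} ≃ (Fin l ↪o Fin k) :=
    { toFun := fun i => OrderEmbedding.ofStrictMono
        (fun j => ⟨(i.1 j : ℕ) - 1, by
          have := i.2.2 j
          have := (i.1 j).pos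
          omega⟩) fun a b hab => by
            have h1 : (i.1 a : ℕ) < i.1 b := i.2.1 hab
            have := (i.1 a).pos
            rw [Fin.mk_lt_mk]
            omega
      invFun := fun f => ⟨fun j => Nat.succPNat (f j), fun a b hab => by
        have : (f a : ℕ) < f b := f.strictMono hab
        exact Nat.succPNat_lt_succPNat.2 this, fun j => (f j).2⟩
      left_inv := fun i => by
        refine Subtype.ext (funext fun j => PNat.eq ?_)
        have := (i.1 j).pos
        change (i.1 j : ℕ) - 1 + 1 = i.1 j
        omega
      right_inv := fun f => by
        ext j
        simp }
  rw [Nat.card_congr (e.trans Set.powersetCard.ofFinEmbEquiv), Set.powersetCard.card,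
    Nat.card_fin]

theorem coeff_monomialQSym {n : ℕ} (α : Composition n) (m : ℕ+ →₀ ℕ) :
    MvPowerSeries.coeff m (monomialQSym α) = (Nat.card {i : Fin α.length → ℕ+ //
      StrictMono i ∧ ∑ j, Finsupp.single (i j) (α.blocksFun j) = m} : ℂ) := by
  rw [monomialQSym, coeff_genFun, Nat.card_congr
    (Equiv.subtypeSubtypeEquivSubtypeInter (fun i : Fin α.length → ℕ+ => StrictMono i)
      fun i => ∑ j, Finsupp.single (i j) (α.blocksFun j) = m)]

/-! ### Expansion of the chromatic invariants by type -/

namespace HopfMonoid.Character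

variable {K : Type*} [Field K] {H : SetSpecies.{u, v}} {X : HopfMonoid (H.linearization K)}
variable {N : Type u} [Fintype N] {n : ℕ}

/-- The permutation characters on the proper colorings of each type. -/
def typeCharacter (φ : X.Character) (h : H.obj N) (n : ℕ) (G : Subgroup (Equiv.Perm N))
    (α : Composition n) (g : G) : ℂ :=
  fixedCount (φ.TypeColorings h α) (g : Equiv.Perm N)

/-- A coloring of type α is `α.index ∘ e` for a suitable order `e`, and `β.index ∘ e` is a proper
preimage of it under merging. -/
theorem effLE_typeCharacter (hX : X.IsLinearized) {φ : X.Character} (hφ : φ.IsBalancedConvex)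
    {h : H.obj N} {G : Subgroup (Equiv.Perm N)} (hG : G ≤ H.aut h) (α β : Composition n)
    (hαβ : Refines α β) : EffLE (φ.typeCharacter h n G α) (φ.typeCharacter h n G β) := by
  obtain ⟨c, hc⟩ := hαβ.exists_index_comp
  refine effLE_fixedCount (fun g hg f hf => typeColorings_perm hf (hG hg))
    (fun g hg f hf => typeColorings_perm hf (hG hg)) c fun f hf => ?_
  obtain ⟨e, he, hβ⟩ := exists_order_of_mem_typeColorings hX hφ hf
  refine ⟨_, hβ β hαβ, ?_⟩
  rw [← he]
  exact funext fun v => hc (e v)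

/-- Only the composition into ones has length `n`, so the top entry of the f-vector counts the
proper colorings with one-point classes; its nonvanishing gives the degree. -/
theorem lengthSum_typeCharacter_self (φ : X.Character) (h : H.obj N)
    (G : Subgroup (Equiv.Perm N)) :
    lengthSum (φ.typeCharacter h n G) n = φ.typeCharacter h n G (Composition.ones n) := by
  rw [lengthSum]
  simp [← Composition.eq_ones_iff_length, Finset.filter_eq']

theorem fixedCount_ones_ne_zero (hX : X.IsLinearized) {φ : X.Character}
    (hφ : φ.IsBalancedConvex) (h : H.obj N) (hn : Nat.card N = n) :
    fixedCount (φ.TypeColorings h (Composition.ones n)) 1 ≠ 0 := by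
  obtain ⟨f, hf⟩ := exists_mem_typeColorings_ones hX hφ h hn
  have : Nonempty {f // f ∈ φ.TypeColorings h (Composition.ones n) ∧
      f ∘ ⇑(1 : Equiv.Perm N)⁻¹ = f} := ⟨f, hf, by simp⟩
  exact Nat.card_pos.ne'

theorem colorWeight_comp {φ : X.Character} {h : H.obj N} {α : Composition n}
    {f : N → Fin α.length} (hf : f ∈ φ.TypeColorings h α) (i : Fin α.length → ℕ+) :
    colorWeight (i ∘ f) = ∑ j, Finsupp.single (i j) (α.blocksFun j) := by
  classical
  rw [colorWeight, ← Finset.sum_fiberwise Finset.univ f]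
  refine Finset.sum_congr rfl fun j _ => ?_
  rw [Finset.sum_congr rfl fun v hv => by
    rw [Function.comp_apply, (Finset.mem_filter.1 hv).2], Finset.sum_const, Finsupp.smul_single,
    smul_eq_mul, _root_.mul_one, ← hf.1 j, Nat.card_eq_fintype_card, Fintype.card_subtype]

theorem coloring_perm {φ : X.Character} {h : H.obj N} {g : Equiv.Perm N} (hg : g ∈ H.aut h)
    {f : N → ℕ+} (hf : f ∈ φ.Colorings h) : f ∘ ⇑g⁻¹ ∈ φ.Colorings h :=
  (φ.isProper_iff h _).2 (((φ.isProper_iff h f).1 hf).perm hg)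

theorem colorWeight_perm (g : Equiv.Perm N) (f : N → ℕ+) :
    colorWeight (f ∘ ⇑g⁻¹) = colorWeight f :=
  Equiv.sum_comp g⁻¹ fun v => Finsupp.single (f v) 1

/-- The proper colorings of a given weight, counted by type. -/
theorem fixedCount_weight (φ : X.Character) (h : H.obj N) (hn : Nat.card N = n)
    (g : Equiv.Perm N) (m : ℕ+ →₀ ℕ) :
    (fixedCount {f | f ∈ φ.Colorings h ∧ colorWeight f = m} g : ℂ) =
      ∑ α : Composition n, (fixedCount (φ.TypeColorings h α) g : ℂ) *
        MvPowerSeries.coeff m (monomialQSym α) := by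
  have := φ.card_colorings_eq_sum h hn g (fun f => colorWeight f = m)
    (fun α i => ∑ j, Finsupp.single (i j) (α.blocksFun j) = m)
    fun α i f hf => by rw [colorWeight_comp hf]
  have h1 : fixedCount {f | f ∈ φ.Colorings h ∧ colorWeight f = m} g = _ :=
    (Nat.card_congr (Equiv.subtypeEquivRight fun f => by
      rw [Set.mem_ofPred_eq, and_assoc, and_comm (a := colorWeight f = m)])).trans this
  rw [h1, Nat.cast_sum]
  simp only [Nat.cast_mul, coeff_monomialQSym, mul_comm]

/-- The proper colorings with at most `k` colors, counted by type. -/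
theorem fixedCount_le (φ : X.Character) (h : H.obj N) (hn : Nat.card N = n)
    (g : Equiv.Perm N) (k : ℕ) :
    fixedCount {f | f ∈ φ.Colorings h ∧ ∀ v, (f v : ℕ) ≤ k} g =
      ∑ α : Composition n, fixedCount (φ.TypeColorings h α) g * k.choose α.length := by
  have := φ.card_colorings_eq_sum h hn g (fun f => ∀ v, (f v : ℕ) ≤ k)
    (fun α i => ∀ j, (i j : ℕ) ≤ k)
    fun α i f hf =>
      ((typeColorings_surjective hf).forall (p := fun j => (i j : ℕ) ≤ k)).symm
  have h1 : fixedCount {f | f ∈ φ.Colorings h ∧ ∀ v, (f v : ℕ) ≤ k} g = _ :=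
    (Nat.card_congr (Equiv.subtypeEquivRight fun f => by
      rw [Set.mem_ofPred_eq, and_assoc, and_comm (a := ∀ v, (f v : ℕ) ≤ k)])).trans this
  rw [h1]
  exact Finset.sum_congr rfl fun α _ => by rw [card_strictMono_le, mul_comm]

/-- A type of length `i` admits binom(k, i) increasing choices of colors, so grouping types by
length exhibits the f-vector. -/
theorem fixedCount_le_eq_sum_lengthSum (φ : X.Character) (h : H.obj N) (hn : Nat.card N = n)
    (G : Subgroup (Equiv.Perm N)) (g : G) (k : ℕ) :
    (fixedCount {f | f ∈ φ.Colorings h ∧ ∀ v, (f v : ℕ) ≤ k} (g : Equiv.Perm N) : ℂ) =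
      ∑ i ∈ Finset.range (n + 1), lengthSum (φ.typeCharacter h n G) i g * k.choose i := by
  rw [fixedCount_le φ h hn]
  push_cast
  rw [← sum_lengthSum_mul (fun α => (fixedCount (φ.TypeColorings h α) (g : Equiv.Perm N) : ℂ))
    fun i => (k.choose i : ℂ)]
  refine Finset.sum_congr rfl fun i _ => ?_
  rw [lengthSum, lengthSum, Finset.sum_apply]
  rfl

theorem chromaticCount_eq_fixedCount (φ : X.Character) (h : H.obj N) (g : Equiv.Perm N) (k : ℕ) :
    φ.chromaticCount h g k = fixedCount {f | f ∈ φ.Colorings h ∧ ∀ v, (f v : ℕ) ≤ k} g :=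
  Nat.card_congr (Equiv.subtypeEquivRight fun f => by
    rw [Set.mem_ofPred_eq, and_assoc, and_comm (a := ∀ v, (f v : ℕ) ≤ k)])

theorem coeff_chromaticQSym (φ : X.Character) (h : H.obj N) (g : Equiv.Perm N) (m : ℕ+ →₀ ℕ) :
    MvPowerSeries.coeff m (φ.chromaticQSym h g) =
      (fixedCount {f | f ∈ φ.Colorings h ∧ colorWeight f = m} g : ℂ) := by
  rw [chromaticQSym, coeff_genFun, fixedCount]
  congr 1
  refine Nat.card_congr ((Equiv.subtypeSubtypeEquivSubtypeInter
    (fun f : N → ℕ+ => f ∈ φ.Colorings h ∧ f ∘ ⇑g⁻¹ = f) fun f => colorWeight f = m).trans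
    (Equiv.subtypeEquivRight fun f => ?_))
  rw [Set.mem_ofPred_eq, and_assoc, and_assoc, and_comm (a := colorWeight f = m)]

/-- The weight is constant on orbits, so the orbits of weight `m` are the orbits on the colorings of
weight `m`. -/
theorem coeff_orbitalQSym (φ : X.Character) (h : H.obj N) (G : Subgroup (Equiv.Perm N))
    (m : ℕ+ →₀ ℕ) :
    MvPowerSeries.coeff m (φ.orbitalQSym h G) =
      (Nat.card (Quotient (orbitSetoid G {f | f ∈ φ.Colorings h ∧ colorWeight f = m})) : ℂ) := by
  rw [orbitalQSym, coeff_genFun]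
  congr 1
  refine (Nat.card_congr (Equiv.ofBijective (Quotient.lift (fun f =>
    ⟨Quotient.mk _ ⟨f.1, f.2.1⟩, f.2.2⟩) ?_) ⟨?_, ?_⟩)).symm
  · intro f f' hff
    exact Subtype.ext (Quotient.sound hff)
  · intro q q'
    induction q using Quotient.ind
    induction q' using Quotient.ind
    intro hq
    exact Quotient.sound (Quotient.exact (s := orbitSetoid G (φ.Colorings h))
      (congrArg Subtype.val hq))
  · rintro ⟨q, hq⟩
    induction q using Quotient.ind with
    | _ f => exact ⟨Quotient.mk _ ⟨f.1, f.2, hq⟩, rfl⟩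

theorem finite_weight (φ : X.Character) (h : H.obj N) (m : ℕ+ →₀ ℕ) :
    Finite ↥{f | f ∈ φ.Colorings h ∧ colorWeight f = m} :=
  finite_forall_mem m.support.finite_toSet fun _ hf _ =>
    mem_support_of_sum_single hf.2 one_ne_zero

theorem finite_le (φ : X.Character) (h : H.obj N) (k : ℕ) :
    Finite ↥{f | f ∈ φ.Colorings h ∧ ∀ v, (f v : ℕ) ≤ k} :=
  finite_forall_mem (finite_le_natCast k) fun _ hf => hf.2

end HopfMonoid.Character

end

/-! ### Proof of the theorem -/

open HopfMonoid.Character in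
theorem mainTheorem1 {K : Type*} [Field K] {H : SetSpecies.{u, v}}
    (X : HopfMonoid (H.linearization K)) (hX : X.IsLinearized)
    (φ : X.Character) (hφ : φ.IsLinearized) (hbal : φ.IsBalancedConvex)
    {N : Type u} [Fintype N] (h : H.obj N)
    (G : Subgroup (Equiv.Perm N)) (hG : G ≤ H.aut h) :
    (IsMIncreasingClass (Fintype.card N) (fun g : G => φ.chromaticQSym h (g : Equiv.Perm N)) ∧
      IsMIncreasing (Fintype.card N) (φ.orbitalQSym h G)) ∧
    (∃ (p : G → Polynomial ℂ) (f : ℕ → G → ℂ),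
      (∀ (g : G) (k : ℕ), (p g).eval (k : ℂ) = φ.chromaticCount h (g : Equiv.Perm N) k) ∧
      IsEquivariantFVector (Fintype.card N) p f ∧
      IsEffectivelyFlawless (Fintype.card N) f ∧
      ∀ i : ℕ, EffLE (((Fintype.card N : ℂ) - (i : ℂ)) • f i) ((i : ℂ) • f (i + 1))) ∧
    (∃ (p : Polynomial ℝ) (f : ℕ → ℝ),
      (∀ k : ℕ, p.eval (k : ℝ) = φ.orbitalCount h G k) ∧
      IsFVector (Fintype.card N) p f ∧
      IsStronglyFlawless (Fintype.card N) f ∧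
      ∀ i : ℕ, ((Fintype.card N : ℝ) - (i : ℝ)) * f i ≤ (i : ℝ) * f (i + 1)) := by
  have hn : Nat.card N = Fintype.card N := Nat.card_eq_fintype_card
  generalize Fintype.card N = n at *
  -- This one increasing family yields all the coefficients: `c` itself and its length sums for Ψ,
  -- and their group averages for the orbital invariants.
  set c := φ.typeCharacter h n G with hc
  have hmono : ∀ α β, Refines α β → EffLE (c α) (c β) := effLE_typeCharacter hX hbal hG
  have hflawless := isEffectivelyFlawless_lengthSum hmono
  have hsucc := effLE_lengthSum_succ hmono
  have hones := fixedCount_ones_ne_zero hX hbal h hn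
  have htop : lengthSum c n = c (Composition.ones n) := lengthSum_typeCharacter_self φ h G
  refine ⟨⟨⟨c, fun g => ?_, hmono⟩, fun α => groupAverage G (c α), ?_, fun α β hαβ =>
    (hmono α β hαβ).groupAverage_le⟩, ⟨fun g => ∑ i ∈ Finset.range (n + 1),
    Polynomial.C (lengthSum c i g) * binomPoly ℂ i, lengthSum c, fun g k => ?_, ⟨?_,
    isEffective_lengthSum hmono, fun g => rfl, fun i => lengthSum_eq_zero c⟩, hflawless, hsucc⟩,
    ∑ i ∈ Finset.range (n + 1), Polynomial.C (groupAverage G (lengthSum c i)) * binomPoly ℝ i,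
    fun i => groupAverage G (lengthSum c i), fun k => ?_, ⟨?_, rfl, fun i hi => ?_⟩,
    ⟨fun i hi => (hflawless.le_succ i hi).groupAverage_le,
      fun i hi => (hflawless.le_reflect i hi).groupAverage_le⟩, fun i => ?_⟩
  · ext m
    rw [coeff_chromaticQSym, fixedCount_weight φ h hn, map_sum]
    rfl
  · ext m
    have := φ.finite_weight h m
    -- Burnside's lemma needs a finite set, so it is applied one weight at a time.
    have hB := card_quotient_orbitSetoid (G := G)
      (F := {f | f ∈ φ.Colorings h ∧ colorWeight f = m}) fun g hg f hf =>
        ⟨coloring_perm (hG hg) hf.1, (colorWeight_perm g f).trans hf.2⟩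
    rw [coeff_orbitalQSym, ← Complex.ofReal_natCast, hB, map_sum]
    have h1 : (fun g : G => (fixedCount {f | f ∈ φ.Colorings h ∧ colorWeight f = m}
        (g : Equiv.Perm N) : ℂ)) = ∑ α : Composition n, ((Nat.card {i : Fin α.length → ℕ+ //
          StrictMono i ∧ ∑ j, Finsupp.single (i j) (α.blocksFun j) = m} : ℝ) : ℂ) • c α := by
      funext g
      rw [fixedCount_weight φ h hn, Finset.sum_apply]
      refine Finset.sum_congr rfl fun α _ => ?_
      rw [coeff_monomialQSym, mul_comm]
      rfl
    rw [h1, map_sum, Complex.ofReal_sum]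
    refine Finset.sum_congr rfl fun α _ => ?_
    rw [groupAverage_ofReal_smul, MvPowerSeries.coeff_smul, coeff_monomialQSym, mul_comm]
    push_cast
    rfl
  · rw [eval_sum_binomPoly, chromaticCount_eq_fixedCount, fixedCount_le_eq_sum_lengthSum φ h hn]
  · refine natDegree_sum_binomPoly (f := fun i => lengthSum c i 1) ?_
    rw [htop]
    exact Nat.cast_ne_zero.2 hones
  · have := φ.finite_le h k
    have hB := card_quotient_orbitSetoid (G := G)
      (F := {f | f ∈ φ.Colorings h ∧ ∀ v, (f v : ℕ) ≤ k}) fun g hg f hf =>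
        ⟨coloring_perm (hG hg) hf.1, fun v => hf.2 (g⁻¹ v)⟩
    rw [eval_sum_binomPoly, orbitalCount, hB]
    have h1 : (fun g : G => (fixedCount {f | f ∈ φ.Colorings h ∧ ∀ v, (f v : ℕ) ≤ k}
        (g : Equiv.Perm N) : ℂ)) =
        ∑ i ∈ Finset.range (n + 1), ((k.choose i : ℝ) : ℂ) • lengthSum c i := by
      funext g
      rw [fixedCount_le_eq_sum_lengthSum φ h hn, Finset.sum_apply]
      refine Finset.sum_congr rfl fun i _ => ?_
      rw [mul_comm]
      rfl
    rw [h1, map_sum]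
    refine Finset.sum_congr rfl fun i _ => ?_
    rw [groupAverage_ofReal_smul, mul_comm]
  · refine natDegree_sum_binomPoly (f := fun i => groupAverage G (lengthSum c i)) ?_
    rw [htop]
    -- The top entry is an average of natural numbers, positive at the identity, so it does not
    -- vanish.
    exact (groupAverage_natCast_pos (G := G)
      (a := fun g => fixedCount (φ.TypeColorings h (Composition.ones n)) g) hones).ne'
  · rw [lengthSum_eq_zero c hi, map_zero]
  · have := (hsucc i).groupAverage_le
    rw [← groupAverage_ofReal_smul, ← groupAverage_ofReal_smul]
    push_cast
    exact this
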